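/- Let $p\ge 2$ be an integer and let $\mathbb N=\{1,2,3,\dots\}$. For $I\subset\mathbb N$ and $n\in\mathbb N$ put $I_n=\{i\in I: i\le n\}$, $$C(I_n)=\Big\{\sum_{i\in I_n} b_i p^{-i}: b_i\in\{0,\dots,p-1\}\Big\},\qquad \Lambda_{I_n}=\Big\{\sum_{i\in I_n} b_i p^{\,i-1}: b_i\in\{0,\dots,p-1\}\Big\},\qquad \Lambda_I=\bigcup_{n}\Lambda_{I_n}.$$ Definitions. A probability measure $\mu$ on $\mathbb R$ is a frame spectral measure with frame spectrum $\Lambda\subset\mathbb R$ if there are constants $A,B>0$ with $A\|f\|^2\le\sum_{\lambda\in\Lambda}|\langle f,e^{2\pi i\lambda x}\rangle|^2\le B\|f\|^2$ for all $f\in L^2(\mu)$; it is a spectral measure with spectrum $\Lambda$ if this holds with $A=B=1$ (equivalently, the functions $e^{2\pi i\lambda x}$, $\lambda\in\Lambda$, form an orthonormal basis of $L^2(\mu)$). The Beurling dimension of $\Lambda\subset\mathbb R$ is $\dim\Lambda=\sup\{r>0:\limsup_{h\to\infty}\sup_{x\in\mathbb R}h^{-r}\,\#(\Lambda\cap B(x,h))>0\}$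 (with $\sup\emptyset=0$). The upper entropy dimension is $\overline{\dim}_e\,\mu=\limsup_{n\to\infty}\frac1n H(\mu,\mathcal D_n)$, where $H(\mu,\mathcal D_n)=-\sum_{D\in\mathcal D_n}\mu(D)\log_2\mu(D)$ and $\mathcal D_n=\{[k2^{-n},(k+1)2^{-n}):k\in\mathbb Z\}$. With $A$ ranging over Borel sets and $\dim_H A$ the Hausdorff dimension, $\underline{\dim}_H\,\mu=\inf\{\dim_H A:\mu(A)>0\}$ and $\overline{\dim}_H\,\mu=\inf\{\dim_H A:\mu(A)=1\}$. For $\mu(K)>0$ let $\mu_K=\mu(\cdot\cap K)/\mu(K)$. Theorem. (1) For every integer $p\ge2$ and every $I\subset\mathbb N$ the uniform probability measures on the finite sets $C(I_n)$ converge weakly, as $n\to\infty$, to a probability measure $\nu_I$ on $\mathbb R$ with compact support, and $$\dim\Lambda_I=\overline{\dim}_e\,\nu_I=\limsup_{n\to\infty}\frac{\#I_n}{n},\qquad \dim_H\operatorname{supp}(\nu_I)=\overline{\dim}_H\,\nu_I=\underline{\dim}_H\,\nu_I=\liminf_{n\to\infty}\frac{\#I_n}{n}.$$ Moreover, with $K\subset\mathbb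 R$ ranging over all sets with $\nu_I(K)>0$ and $\nu_I(\partial K)=0$, $$\overline{\dim}_e\,\nu_I=\inf_K\overline{\dim}_e\,(\nu_I)_K,\qquad \dim_H\operatorname{supp}(\nu_I)=\inf_K\overline{\dim}_H\,(\nu_I)_K=\inf_K\underline{\dim}_H\,(\nu_I)_K.$$ If $\mathbb N\setminus I$ is infinite, then $\nu_I$ is a spectral measure with spectrum $\Lambda_I$. In particular, if $\liminf_{n\to\infty}\#I_n/n<\limsup_{n\to\infty}\#I_n/n$, then $\nu_I$ is a spectral measure with spectrum $\Lambda_I$ and $\dim\Lambda_I>\dim_H\operatorname{supp}(\nu_I)$. (2) There are sets $I\subset\mathbb N$ with $\liminf_{n\to\infty}\#I_n/n<\limsup_{n\to\infty}\#I_n/n$. (3) Consequently it is not true that $\dim\Lambda\le\dim_H\operatorname{supp}(\mu)$ for every frame spectral probability measure $\mu$ on $\mathbb R$ with compact support and every countable frame spectrum $\Lambda$ of $\mu$. -/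

import Mathlib

open MeasureTheory Filter Set
open scoped ENNReal NNReal Topology

noncomputable section

namespace BeurlingDim

/-! ### Frame spectra and spectra of a measure on the line -/

/-- The coefficient `⟨f, e_t⟩` in `L²(μ)`, where `e_t(x) = exp(2πitx)`. -/
def expCoeff (μ : Measure ℝ) (f : ℝ → ℂ) (t : ℝ) : ℂ :=
  ∫ x, f x * (starRingEnd ℂ) (Complex.exp (2 * Real.pi * Complex.I * t * x)) ∂μ

/-- The exponentials `e_t`, `t ∈ Λ`, form a frame of `L²(μ)` with bounds `A` and `B`:
`A ‖f‖² ≤ ∑_{t ∈ Λ} |⟨f, e_t⟩|² ≤ B ‖f‖²` for every `f ∈ L²(μ)`. -/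
def HasFrameBounds (μ : Measure ℝ) (Λ : Set ℝ) (A B : ℝ≥0) : Prop :=
  ∀ f : ℝ → ℂ, MemLp f 2 μ →
    (A : ℝ≥0∞) * eLpNorm f 2 μ ^ 2 ≤ ∑' t : Λ, ‖expCoeff μ f t‖ₑ ^ 2 ∧
    ∑' t : Λ, ‖expCoeff μ f t‖ₑ ^ 2 ≤ (B : ℝ≥0∞) * eLpNorm f 2 μ ^ 2

/-- `μ` is a frame spectral measure with frame spectrum `Λ`. -/
def IsFrameSpectrum (μ : Measure ℝ) (Λ : Set ℝ) : Prop :=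
  ∃ A B : ℝ≥0, 0 < A ∧ 0 < B ∧ HasFrameBounds μ Λ A B

/-- The probability measure `μ` is a spectral measure with spectrum `Λ`: both frame bounds
are `1`. As every `e_t` is a unit vector of `L²(μ)`, this says that `(e_t)_{t ∈ Λ}` is an
orthonormal basis of `L²(μ)`. -/
def IsSpectrum (μ : Measure ℝ) [IsProbabilityMeasure μ] (Λ : Set ℝ) : Prop :=
  HasFrameBounds μ Λ 1 1

/-! ### Dimensions -/

/-- The Shannon entropy, in base `2`, of `μ` with respect to the partition of the line into
the intervals `[k / 2 ^ n, (k + 1) / 2 ^ n)`, `k ∈ ℤ`. -/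
def dyadicEntropy (μ : Measure ℝ) [IsProbabilityMeasure μ] (n : ℕ) : ℝ≥0∞ :=
  ∑' k : ℤ, ENNReal.ofReal
    (-(μ.real (Ico ((k : ℝ) / 2 ^ n) (((k : ℝ) + 1) / 2 ^ n)) *
      Real.logb 2 (μ.real (Ico ((k : ℝ) / 2 ^ n) (((k : ℝ) + 1) / 2 ^ n)))))

/-- The upper entropy dimension of a probability measure. -/
def upperEntropyDim (μ : Measure ℝ) [IsProbabilityMeasure μ] : ℝ≥0∞ :=
  limsup (fun n : ℕ => dyadicEntropy μ n / (n : ℝ≥0∞)) atTop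

/-- The lower Hausdorff dimension of a probability measure. -/
def lowerHausdorffDim (μ : Measure ℝ) [IsProbabilityMeasure μ] : ℝ≥0∞ :=
  ⨅ (A : Set ℝ) (_ : MeasurableSet A) (_ : 0 < μ A), dimH A

/-- The upper Hausdorff dimension of a probability measure. -/
def upperHausdorffDim (μ : Measure ℝ) [IsProbabilityMeasure μ] : ℝ≥0∞ :=
  ⨅ (A : Set ℝ) (_ : MeasurableSet A) (_ : μ A = 1), dimH A

/-- The upper Beurling density of `Λ` corresponding to `r`. -/
def upperBeurlingDensity (Λ : Set ℝ) (r : ℝ) : ℝ≥0∞ :=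
  limsup (fun h : ℝ =>
    ⨆ x : ℝ, ((Λ ∩ Metric.ball x h).encard : ℝ≥0∞) / ENNReal.ofReal (h ^ r)) atTop

/-- The (upper) Beurling dimension of `Λ` (it is `0` if all the densities vanish). -/
def beurlingDim (Λ : Set ℝ) : ℝ≥0∞ :=
  ⨆ (r : ℝ) (_ : 0 < r) (_ : 0 < upperBeurlingDensity Λ r), ENNReal.ofReal r

/-- The normalised restriction `μ(· ∩ K) / μ(K)` to a set of positive measure. -/
def condOn (μ : ProbabilityMeasure ℝ) (K : Set ℝ) : Measure ℝ :=
  ProbabilityTheory.cond (μ : Measure ℝ) K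

/-- The sets `K` over which restrictions are taken: those with `μ(K) > 0`, `μ(∂K) = 0`. -/
def RestrictionSet (μ : ProbabilityMeasure ℝ) : Type :=
  {K : Set ℝ // 0 < (μ : Measure ℝ) K ∧ (μ : Measure ℝ) (frontier K) = 0}

instance (μ : ProbabilityMeasure ℝ) (K : RestrictionSet μ) :
    IsProbabilityMeasure (condOn μ K.1) :=
  ProbabilityTheory.cond_isProbabilityMeasure K.2.1.ne'

/-! ### The Cantor-type measures and their spectra -/

/-- `I_n`, the set of the positive integers `i ≤ n` that lie in `I`. -/
def initialPart (I : Set ℕ) (n : ℕ) : Finset ℕ :=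
  open Classical in (Finset.Icc 1 n).filter (fun i => i ∈ I)

/-- `liminf #I_n / n`. -/
def lowerDensity (I : Set ℕ) : ℝ≥0∞ :=
  liminf (fun n : ℕ => ((initialPart I n).card : ℝ≥0∞) / (n : ℝ≥0∞)) atTop

/-- `limsup #I_n / n`. -/
def upperDensity (I : Set ℕ) : ℝ≥0∞ :=
  limsup (fun n : ℕ => ((initialPart I n).card : ℝ≥0∞) / (n : ℝ≥0∞)) atTop

/-- `C(I_n)`, the set of the sums `∑_{i ∈ I_n} b_i p^{-i}` with digits `b_i ∈ {0, …, p - 1}`. -/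
def cantorPart (p : ℕ) (I : Set ℕ) (n : ℕ) : Set ℝ :=
  range fun b : initialPart I n → Fin p =>
    ∑ i : initialPart I n, ((b i : ℕ) : ℝ) * ((p : ℝ) ^ (i : ℕ))⁻¹

/-- The set of the sums `∑_{i ∈ I_n} b_i p^{i-1}` with digits `b_i ∈ {0, …, p - 1}`. -/
def spectrumPart (p : ℕ) (I : Set ℕ) (n : ℕ) : Set ℝ :=
  range fun b : initialPart I n → Fin p =>
    ∑ i : initialPart I n, ((b i : ℕ) : ℝ) * (p : ℝ) ^ ((i : ℕ) - 1)

/-- `Λ_I`, the union of the sets `Λ_{I_n}`. -/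
def cantorSpectrum (p : ℕ) (I : Set ℕ) : Set ℝ :=
  ⋃ n : ℕ, spectrumPart p I n

/-- The uniform probability measure on the finite set `C(I_n)`. -/
def cantorApprox (p : ℕ) (hp : 2 ≤ p) (I : Set ℕ) (n : ℕ) : ProbabilityMeasure ℝ :=
  ⟨ProbabilityTheory.uniformOn (cantorPart p I n), by
    haveI : NeZero p := ⟨by omega⟩
    exact ProbabilityTheory.isProbabilityMeasure_uniformOn
      (Set.finite_range _) (Set.range_nonempty _)⟩

end BeurlingDim

end

/-!
# Cantor-type spectral measures whose spectra are larger than their supports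

The measure `ν_I` is the law of the random series `X = ∑_{i ∈ I} ω_i p^{-i}`, whose digits `ω_i` are
independent and uniform in `{0, …, p - 1}` (`cantorMeasure`). For every `n` it splits as
`X = Y_n + Z_n`, where the partial sum `Y_n` is uniformly distributed on `C(I_n)`, the tail `Z_n`
lies in `[0, p^{-n}]`, and `Y_n` and `Z_n` are independent (`digitSum_eq_add`,
`cantorApprox_eq_map`, `indepFun_digitSum`). Weak convergence follows from `Y_n → X`.

*Dimensions.* At the scale `p^{-m}` the measure is carried by `p^{#I_m}` intervals
(`cantorCover`), and every interval of that length has mass at most `4 p^{-#I_m}`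
(`cantorMeasure_Icc_le`). These two facts give the Hausdorff dimensions, by the mass distribution
principle and by coverings along the scales that realise the lower limit, and the entropy
dimension, whose lower bound holds for every measure with bounded density with respect to `ν_I`, in
particular for the normalised restrictions. On the dual side, a ball of radius `p^m` contains at
most `3 p^{#I_m}` frequencies, and the one around `0` contains at least `p^{#I_m}`; this gives the
Beurling dimension. Entropy and Beurling dimension are governed by the scales where `#I_m / m` is
largest, the Hausdorff dimension by those where it is smallest.

*Spectrality.* Two frequencies in `Λ_{I_n}` differ by `p^{j-1} c` with `j ∈ I_n` and `p ∤ c`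
(`exists_spectrumPoint_sub`), and averaging the exponential over the `j`-th digit gives `0`; hence
the exponentials are orthonormal. As there are as many frequencies in `Λ_{I_n}` as points in
`C(I_n)`, Parseval's identity holds for `Y_n` (`sum_norm_sq_integral_initialPart`). If `n + 1 ∉ I`,
the Fourier transform of `Z_n` has modulus at least `1/2` on `Λ_{I_n}`
(`half_le_norm_integral_expo_tail`). If `f` is orthogonal to all exponentials and `g` is bounded and
continuous, then the coefficients of `g(Y_n)` along the exponentials `e_λ(X)`, `λ ∈ Λ_{I_n}`, are
those of `g(Y_n) - f(X)`. By Parseval and the lower bound for the tail their squares add up to at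
least `‖g(Y_n)‖² / 4`, and by Bessel to at most `‖g(Y_n) - f(X)‖²`. Letting `n → ∞` with `n + 1 ∉ I`
gives `‖g‖² ≤ 4 ‖g - f‖²`, and approximating `f` by `g` gives `f = 0`
(`integral_norm_sq_le_of_orthogonal`, `toLp_eq_zero_of_orthogonal`).
-/

namespace BeurlingDim

/-! ### Digit strings -/

/-- Two different strings of digits give different numbers; more precisely, the difference of the
numbers is a power of the base coming from one of the positions, times an integer that the base
does not divide (look at the lowest position where the strings differ). -/
theorem exists_sum_mul_pow_eq {ι : Type*} [Fintype ι] {p : ℕ} (e : ι → ℕ)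
    (he : Function.Injective e) (D : ι → ℤ) (hD : ∀ i, |D i| < p) (h : D ≠ 0) :
    ∃ j, ∃ c : ℤ, ¬ (p : ℤ) ∣ c ∧ ∑ i, D i * (p : ℤ) ^ e i = (p : ℤ) ^ e j * c := by
  classical
  have hne : (Finset.univ.filter fun i => D i ≠ 0).Nonempty := by
    obtain ⟨i, hi⟩ := Function.ne_iff.1 h
    exact ⟨i, by simpa using hi⟩
  obtain ⟨j, hj, hmin⟩ := Finset.exists_min_image _ e hne
  have hj0 : D j ≠ 0 := by simpa using hj
  have hdvd : (p : ℤ) ^ (e j + 1) ∣ ∑ i ∈ Finset.univ.erase j, D i * (p : ℤ) ^ e i := by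
    refine Finset.dvd_sum fun i hi => ?_
    by_cases h0 : D i = 0
    · simp [h0]
    · have h1 := hmin i (by simpa using h0)
      have h2 : e i ≠ e j := fun h => (Finset.ne_of_mem_erase hi) (he h)
      exact Dvd.dvd.mul_left (pow_dvd_pow _ (by omega)) _
  obtain ⟨q, hq⟩ := hdvd
  refine ⟨j, D j + p * q, ?_, ?_⟩
  · rw [Int.dvd_add_left (dvd_mul_right _ _)]
    intro hd
    exact hj0 (Int.eq_zero_of_abs_lt_dvd hd (hD j))
  · rw [← Finset.add_sum_erase _ _ (Finset.mem_univ j), hq]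
    ring

/-- The number `∑ b_i p^{-i}` with digits `b`. -/
noncomputable def cantorPoint {p : ℕ} {S : Finset ℕ} (b : S → Fin p) : ℝ :=
  ∑ i : S, ((b i : ℕ) : ℝ) * ((p : ℝ) ^ (i : ℕ))⁻¹

/-- The natural number `∑ b_i p^{i-1}` with digits `b`. -/
def spectrumPoint {p : ℕ} {S : Finset ℕ} (b : S → Fin p) : ℕ :=
  ∑ i : S, (b i : ℕ) * p ^ ((i : ℕ) - 1)

theorem cantorPart_eq (p : ℕ) (I : Set ℕ) (n : ℕ) :
    cantorPart p I n = range (cantorPoint (p := p) (S := initialPart I n)) := rfl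

theorem spectrumPart_eq (p : ℕ) (I : Set ℕ) (n : ℕ) :
    spectrumPart p I n =
      range fun b : initialPart I n → Fin p => ((spectrumPoint b : ℕ) : ℝ) := by
  simp [spectrumPart, spectrumPoint]

theorem mem_initialPart {I : Set ℕ} {n i : ℕ} : i ∈ initialPart I n ↔ 1 ≤ i ∧ i ≤ n ∧ i ∈ I := by
  simp [initialPart, and_assoc]

theorem initialPart_mono (I : Set ℕ) {m n : ℕ} (h : m ≤ n) : initialPart I m ⊆ initialPart I n := by
  intro i
  simp only [mem_initialPart]
  exact fun ⟨h1, h2, h3⟩ => ⟨h1, h2.trans h, h3⟩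

theorem card_initialPart_le (I : Set ℕ) (n : ℕ) : (initialPart I n).card ≤ n := by
  classical
  refine (Finset.card_filter_le _ _).trans (by simp)

theorem abs_sub_digit_lt {p : ℕ} (a b : Fin p) : |((a : ℕ) : ℤ) - ((b : ℕ) : ℤ)| < p := by
  have := a.2
  have := b.2
  rw [abs_lt]
  omega

theorem sub_digits_ne_zero {p : ℕ} {ι : Type*} {b b' : ι → Fin p} (h : b ≠ b') :
    (fun i => ((b i : ℕ) : ℤ) - ((b' i : ℕ) : ℤ)) ≠ 0 := by
  intro h0
  refine h (funext fun i => Fin.ext ?_)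
  have := congrFun h0 i
  simp only [Pi.zero_apply] at this
  omega

/-- The difference of two frequencies is `p^{j-1} c` with `j ∈ S` and `c` not divisible by `p`. -/
theorem exists_spectrumPoint_sub {p : ℕ} {S : Finset ℕ} (hS : ∀ i ∈ S, 1 ≤ i)
    {b b' : S → Fin p} (h : b ≠ b') :
    ∃ j ∈ S, ∃ c : ℤ, ¬ (p : ℤ) ∣ c ∧
      (spectrumPoint b : ℤ) - spectrumPoint b' = (p : ℤ) ^ (j - 1) * c := by
  have hinj : Function.Injective fun i : S => (i : ℕ) - 1 := by
    intro i i' hii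
    have := hS i i.2
    have := hS i' i'.2
    simp only at hii
    exact Subtype.ext (by omega)
  obtain ⟨j, c, hc, hsum⟩ := exists_sum_mul_pow_eq (p := p) _ hinj
    (fun i => ((b i : ℕ) : ℤ) - ((b' i : ℕ) : ℤ)) (fun i => abs_sub_digit_lt _ _)
    (sub_digits_ne_zero h)
  refine ⟨j, j.2, c, hc, ?_⟩
  rw [← hsum]
  simp [spectrumPoint, sub_mul, Finset.sum_sub_distrib]

theorem spectrumPoint_injective {p : ℕ} {S : Finset ℕ} (hS : ∀ i ∈ S, 1 ≤ i) :
    Function.Injective (spectrumPoint (p := p) (S := S)) := by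
  intro b b' hbb
  by_contra hne
  obtain ⟨j, -, c, hc, h⟩ := exists_spectrumPoint_sub hS hne
  have hp : p ≠ 0 := by
    rintro rfl
    obtain ⟨i, hi⟩ := Function.ne_iff.1 hne
    exact (b i).elim0
  rw [hbb, sub_self, eq_comm, mul_eq_zero] at h
  rcases h with h | h
  · exact hp (by exact_mod_cast eq_zero_of_pow_eq_zero h)
  · exact hc (by simp [h])

theorem exists_int_cantorPoint {p : ℕ} (hp : p ≠ 0) {S : Finset ℕ} {n : ℕ} (hS : ∀ i ∈ S, i ≤ n)
    (b : S → Fin p) : cantorPoint b * (p : ℝ) ^ n =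
      ((∑ i : S, ((b i : ℕ) : ℤ) * (p : ℤ) ^ (n - (i : ℕ)) : ℤ) : ℝ) := by
  have hp' : (p : ℝ) ≠ 0 := by exact_mod_cast hp
  simp only [cantorPoint, Finset.sum_mul]
  push_cast
  refine Finset.sum_congr rfl fun i _ => ?_
  rw [mul_assoc, pow_sub₀ _ hp' (hS i i.2), mul_comm ((p : ℝ) ^ n)]

theorem cantorPoint_injective {p : ℕ} {S : Finset ℕ} :
    Function.Injective (cantorPoint (p := p) (S := S)) := by
  intro b b' hbb
  by_contra hne
  have hp : p ≠ 0 := by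
    rintro rfl
    obtain ⟨i, hi⟩ := Function.ne_iff.1 hne
    exact (b i).elim0
  obtain ⟨n, hn⟩ := S.exists_le
  have h := exists_int_cantorPoint hp hn b
  rw [hbb, exists_int_cantorPoint hp hn b'] at h
  have h' := (Int.cast_injective h).symm
  have hinj : Function.Injective fun i : S => n - (i : ℕ) := by
    intro i i' hii
    have := hn i i.2
    have := hn i' i'.2
    simp only at hii
    exact Subtype.ext (by omega)
  obtain ⟨j, c, hc, hsum⟩ := exists_sum_mul_pow_eq (p := p) _ hinj
    (fun i => ((b i : ℕ) : ℤ) - ((b' i : ℕ) : ℤ)) (fun i => abs_sub_digit_lt _ _)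
    (sub_digits_ne_zero hne)
  simp only [sub_mul, Finset.sum_sub_distrib] at hsum
  rw [h', sub_self, eq_comm, mul_eq_zero] at hsum
  rcases hsum with h | h
  · exact hp (by exact_mod_cast eq_zero_of_pow_eq_zero h)
  · exact hc (by simp [h])

/-! ### Random digits -/

/-- The law of a sequence of independent digits, uniformly distributed in `{0, …, p - 1}`. -/
noncomputable def digitMeasure (p : ℕ) : Measure (ℕ → Fin p) :=
  Measure.infinitePi fun _ => ProbabilityTheory.uniformOn univ

instance (p : ℕ) [NeZero p] :
    IsProbabilityMeasure (ProbabilityTheory.uniformOn (univ : Set (Fin p))) :=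
  ProbabilityTheory.isProbabilityMeasure_uniformOn finite_univ univ_nonempty

instance (p : ℕ) [NeZero p] : IsProbabilityMeasure (digitMeasure p) := by
  unfold digitMeasure
  infer_instance

/-- The random number `∑_{i ∈ J} ω_i p^{-i}`. -/
noncomputable def digitSum {p : ℕ} (J : Set ℕ) (ω : ℕ → Fin p) : ℝ :=
  ∑' i, J.indicator (fun i => ((ω i : ℕ) : ℝ) * ((p : ℝ) ^ i)⁻¹) i

variable {p : ℕ}

theorem summable_digitSum (hp : 2 ≤ p) (J : Set ℕ) (ω : ℕ → Fin p) :
    Summable (J.indicator fun i => ((ω i : ℕ) : ℝ) * ((p : ℝ) ^ i)⁻¹) := by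
  refine Summable.indicator ?_ J
  have hp' : (2 : ℝ) ≤ p := by exact_mod_cast hp
  refine Summable.of_nonneg_of_le (fun i => by positivity) (fun i => ?_)
    ((summable_geometric_of_lt_one (r := (p : ℝ)⁻¹) (by positivity)
      (inv_lt_one_of_one_lt₀ (by linarith))).mul_left (p : ℝ))
  rw [inv_pow]
  gcongr
  exact (ω i).2.le

theorem digitSum_nonneg (J : Set ℕ) (ω : ℕ → Fin p) : 0 ≤ digitSum J ω :=
  tsum_nonneg fun i => indicator_nonneg (fun _ _ => by positivity) i

/-- Digits at the positions beyond `n` add up to at most `p^{-n}`. -/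
theorem digitSum_le (hp : 2 ≤ p) {J : Set ℕ} {n : ℕ} (hJ : ∀ i ∈ J, n < i) (ω : ℕ → Fin p) :
    digitSum J ω ≤ ((p : ℝ) ^ n)⁻¹ := by
  have hp' : (2 : ℝ) ≤ p := by exact_mod_cast hp
  have h0 : ∑ i ∈ Finset.range (n + 1),
      J.indicator (fun i => ((ω i : ℕ) : ℝ) * ((p : ℝ) ^ i)⁻¹) i = 0 := by
    refine Finset.sum_eq_zero fun i hi => indicator_of_notMem (fun hiJ => ?_) _
    have := hJ i hiJ
    have := Finset.mem_range.1 hi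
    omega
  rw [digitSum, ← (summable_digitSum hp J ω).sum_add_tsum_nat_add (n + 1), h0, zero_add]
  have hg : HasSum (fun i : ℕ => ((p : ℝ) - 1) * ((p : ℝ) ^ (n + 1))⁻¹ * ((p : ℝ)⁻¹) ^ i)
      (((p : ℝ) ^ n)⁻¹) := by
    have := (hasSum_geometric_of_lt_one (r := (p : ℝ)⁻¹) (by positivity)
      (inv_lt_one_of_one_lt₀ (by linarith))).mul_left (((p : ℝ) - 1) * ((p : ℝ) ^ (n + 1))⁻¹)
    convert! this using 1
    have h1 : (p : ℝ) - 1 ≠ 0 := by linarith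
    have h2 : (1 : ℝ) - (p : ℝ)⁻¹ = ((p : ℝ) - 1) * (p : ℝ)⁻¹ := by field_simp
    rw [h2]
    field_simp
    ring
  refine (Summable.tsum_le_tsum (fun i => ?_)
    ((summable_nat_add_iff (n + 1)).2 (summable_digitSum hp J ω)) hg.summable).trans_eq hg.tsum_eq
  refine (indicator_le_self' (fun _ _ => by positivity) _).trans ?_
  have h3 : ((p : ℝ) ^ (i + (n + 1)))⁻¹ = ((p : ℝ) ^ (n + 1))⁻¹ * ((p : ℝ)⁻¹) ^ i := by
    rw [pow_add, mul_inv, inv_pow, mul_comm]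
  rw [h3, mul_assoc]
  gcongr
  have := (ω (i + (n + 1))).2
  have h4 : ((ω (i + (n + 1)) : ℕ) : ℝ) + 1 ≤ p := by exact_mod_cast this
  linarith

theorem digitSum_union (hp : 2 ≤ p) {J J' : Set ℕ} (h : Disjoint J J') (ω : ℕ → Fin p) :
    digitSum (J ∪ J') ω = digitSum J ω + digitSum J' ω := by
  simp only [digitSum]
  rw [← (summable_digitSum hp J ω).tsum_add (summable_digitSum hp J' ω),
    indicator_union_of_disjoint h]

theorem digitSum_coe (S : Finset ℕ) (ω : ℕ → Fin p) :
    digitSum (S : Set ℕ) ω = cantorPoint (S.restrict ω) := by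
  rw [digitSum, tsum_eq_sum (s := S) fun i hi => indicator_of_notMem (by simpa using hi) _,
    cantorPoint, ← Finset.sum_coe_sort]
  refine Finset.sum_congr rfl fun i _ => ?_
  rw [indicator_of_mem (by simp)]
  rfl

theorem digitSum_singleton (j : ℕ) (ω : ℕ → Fin p) :
    digitSum {j} ω = ((ω j : ℕ) : ℝ) * ((p : ℝ) ^ j)⁻¹ := by
  rw [digitSum, tsum_eq_single j fun i hi => indicator_of_notMem (by simpa using hi) _]
  simp

theorem measurable_tsum_of_summable {α : Type*} {m : MeasurableSpace α} {f : ℕ → α → ℝ}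
    (hf : ∀ i, Measurable (f i)) (hs : ∀ x, Summable fun i => f i x) :
    Measurable fun x => ∑' i, f i x :=
  measurable_of_tendsto_metrizable
    (f := fun N x => ∑ i ∈ Finset.range N, f i x)
    (fun _ => Finset.measurable_fun_sum _ fun i _ => hf i)
    (tendsto_pi_nhds.2 fun x => (hs x).hasSum.tendsto_sum_nat)

/-- `digitSum J` depends on the digits at positions in `J` only. -/
theorem measurable_digitSum_iSup (hp : 2 ≤ p) (J : Set ℕ) :
    Measurable[⨆ i ∈ J, MeasurableSpace.comap (fun ω : ℕ → Fin p => ω i) inferInstance]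
      (digitSum (p := p) J) := by
  refine measurable_tsum_of_summable (m := ⨆ i ∈ J, MeasurableSpace.comap
    (fun ω : ℕ → Fin p => ω i) inferInstance) (fun i => ?_) (summable_digitSum hp J)
  by_cases hi : i ∈ J
  · simp only [indicator_of_mem hi]
    have h1 : Measurable fun a : Fin p => ((a : ℕ) : ℝ) * ((p : ℝ) ^ i)⁻¹ := measurable_of_finite _
    have h2 : Measurable[MeasurableSpace.comap (fun ω : ℕ → Fin p => ω i) inferInstance]
        (fun ω : ℕ → Fin p => ω i) :=
      measurable_iff_comap_le.2 le_rfl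
    exact (h1.comp h2).mono (le_iSup₂_of_le i hi le_rfl) le_rfl
  · simp only [indicator_of_notMem hi]
    exact @measurable_const _ _ _ (_) _

theorem measurable_digitSum (hp : 2 ≤ p) (J : Set ℕ) : Measurable (digitSum (p := p) J) :=
  (measurable_digitSum_iSup hp J).mono
    (iSup₂_le fun i _ => (measurable_pi_apply i).comap_le) le_rfl

theorem indepFun_digitSum (hp : 2 ≤ p) {J J' : Set ℕ} (h : Disjoint J J') :
    ProbabilityTheory.IndepFun (digitSum (p := p) J) (digitSum J') (digitMeasure p) := by
  have : NeZero p := ⟨by omega⟩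
  have hi : ProbabilityTheory.iIndepFun (fun (i : ℕ) (ω : ℕ → Fin p) => ω i) (digitMeasure p) :=
    ProbabilityTheory.iIndepFun_infinitePi (X := fun _ x => x) fun _ => measurable_id
  have := ProbabilityTheory.indep_iSup_of_disjoint
    (fun i => (measurable_pi_apply (X := fun _ => Fin p) i).comap_le) hi h
  rw [ProbabilityTheory.IndepFun_iff_Indep]
  exact ProbabilityTheory.indep_of_indep_of_le_left
    (ProbabilityTheory.indep_of_indep_of_le_right this (measurable_digitSum_iSup hp J').comap_le)
    (measurable_digitSum_iSup hp J).comap_le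

theorem digitMeasure_restrict_eq [NeZero p] (S : Finset ℕ) (b : S → Fin p) :
    digitMeasure p {ω | S.restrict ω = b} = ((p : ℝ≥0∞) ^ S.card)⁻¹ := by
  classical
  have hset : {ω : ℕ → Fin p | S.restrict ω = b} =
      Set.pi S fun i => if h : i ∈ S then {b ⟨i, h⟩} else univ := by
    ext ω
    simp only [mem_ofPred_eq, Set.mem_pi, funext_iff, Finset.restrict, Subtype.forall,
      Finset.mem_coe]
    refine forall₂_congr fun i hi => ?_
    simp [hi]
  rw [hset, digitMeasure, Measure.infinitePi_pi _ (fun i _ => MeasurableSet.of_discrete),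
    ← Finset.prod_coe_sort, Finset.prod_congr rfl (g := fun _ => (p : ℝ≥0∞)⁻¹)]
  · simp [ENNReal.inv_pow]
  · intro i _
    rw [dif_pos i.2, ProbabilityTheory.uniformOn_univ]
    simp

theorem integral_restrict_digitMeasure [NeZero p] {E : Type*} [NormedAddCommGroup E]
    [NormedSpace ℝ E] [CompleteSpace E] (S : Finset ℕ) (F : (S → Fin p) → E) :
    ∫ ω, F (S.restrict ω) ∂digitMeasure p = ((p : ℝ) ^ S.card)⁻¹ • ∑ b, F b := by
  have hm : Measurable (S.restrict : (ℕ → Fin p) → (S → Fin p)) := Finset.measurable_restrict S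
  have : IsProbabilityMeasure ((digitMeasure p).map S.restrict) :=
    Measure.isProbabilityMeasure_map hm.aemeasurable
  rw [← integral_map (φ := S.restrict) (f := F) hm.aemeasurable
    StronglyMeasurable.of_discrete.aestronglyMeasurable,
    integral_fintype (Integrable.of_finite), Finset.smul_sum]
  refine Finset.sum_congr rfl fun b _ => ?_
  congr 1
  have h1 := digitMeasure_restrict_eq S b
  have h2 := Measure.map_apply (μ := digitMeasure p) hm (measurableSet_singleton b)
  rw [Measure.real, h2]
  refine (congrArg ENNReal.toReal h1).trans ?_
  simp

/-! ### The limit measure -/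

/-- The law of the random number `∑_{i ∈ I} ω_i p^{-i}` with independent uniform digits; only the
positive elements of `I` count. -/
noncomputable def cantorMeasure (p : ℕ) (I : Set ℕ) : Measure ℝ :=
  (digitMeasure p).map (digitSum (I ∩ Ioi 0))

theorem isProbabilityMeasure_cantorMeasure (hp : 2 ≤ p) (I : Set ℕ) :
    IsProbabilityMeasure (cantorMeasure p I) := by
  have : NeZero p := ⟨by omega⟩
  exact Measure.isProbabilityMeasure_map (measurable_digitSum hp _).aemeasurable

/-- `cantorMeasure` as a bundled probability measure. -/
noncomputable def cantorProb (p : ℕ) (hp : 2 ≤ p) (I : Set ℕ) : ProbabilityMeasure ℝ :=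
  ⟨cantorMeasure p I, isProbabilityMeasure_cantorMeasure hp I⟩

theorem coe_cantorProb (hp : 2 ≤ p) (I : Set ℕ) :
    (cantorProb p hp I : Measure ℝ) = cantorMeasure p I := rfl

theorem cantorMeasure_apply (hp : 2 ≤ p) (I : Set ℕ) {A : Set ℝ} (hA : MeasurableSet A) :
    cantorMeasure p I A = digitMeasure p {ω | digitSum (I ∩ Ioi 0) ω ∈ A} :=
  Measure.map_apply (measurable_digitSum hp _) hA

theorem coe_initialPart (I : Set ℕ) (n : ℕ) : (initialPart I n : Set ℕ) = I ∩ Ioc 0 n := by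
  ext i
  simp only [Finset.mem_coe, mem_initialPart, mem_inter_iff, mem_Ioc]
  constructor
  · exact fun ⟨h1, h2, h3⟩ => ⟨h3, h1, h2⟩
  · exact fun ⟨h3, h1, h2⟩ => ⟨h1, h2, h3⟩

theorem disjoint_initialPart_tail (I : Set ℕ) (n : ℕ) :
    Disjoint (initialPart I n : Set ℕ) (I ∩ Ioi n) := by
  rw [Set.disjoint_left]
  intro i hi hi'
  have := (mem_initialPart.1 (Finset.mem_coe.1 hi)).2.1
  exact absurd hi'.2 (not_lt.2 this)

theorem inter_Ioi_zero (I : Set ℕ) (n : ℕ) :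
    I ∩ Ioi 0 = (initialPart I n : Set ℕ) ∪ (I ∩ Ioi n) := by
  rw [coe_initialPart, ← inter_union_distrib_left, Ioc_union_Ioi_eq_Ioi (Nat.zero_le n)]

theorem digitSum_eq_add (hp : 2 ≤ p) (I : Set ℕ) (n : ℕ) (ω : ℕ → Fin p) :
    digitSum (I ∩ Ioi 0) ω =
      digitSum (initialPart I n : Set ℕ) ω + digitSum (I ∩ Ioi n) ω := by
  rw [inter_Ioi_zero I n, digitSum_union hp (disjoint_initialPart_tail I n)]

theorem digitSum_tail_le (hp : 2 ≤ p) (I : Set ℕ) (n : ℕ) (ω : ℕ → Fin p) :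
    digitSum (I ∩ Ioi n) ω ≤ ((p : ℝ) ^ n)⁻¹ :=
  digitSum_le hp (fun _ hi => hi.2) ω

theorem tendsto_inv_pow (hp : 2 ≤ p) : Tendsto (fun n => ((p : ℝ) ^ n)⁻¹) atTop (𝓝 0) := by
  have hp' : (2 : ℝ) ≤ p := by exact_mod_cast hp
  exact tendsto_inv_atTop_zero.comp (tendsto_pow_atTop_atTop_of_one_lt (by linarith))

theorem tendsto_digitSum_initialPart (hp : 2 ≤ p) (I : Set ℕ) (ω : ℕ → Fin p) :
    Tendsto (fun n => digitSum (initialPart I n : Set ℕ) ω) atTop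
      (𝓝 (digitSum (I ∩ Ioi 0) ω)) := by
  have h : Tendsto (fun n => digitSum (I ∩ Ioi n) ω) atTop (𝓝 0) :=
    squeeze_zero (fun n => digitSum_nonneg _ _) (fun n => digitSum_tail_le hp I n ω)
      (tendsto_inv_pow hp)
  have h2 := (tendsto_const_nhds (x := digitSum (I ∩ Ioi 0) ω)).sub h
  rw [sub_zero] at h2
  refine h2.congr fun n => ?_
  rw [digitSum_eq_add hp I n]
  ring

theorem map_restrict_digitMeasure [NeZero p] (S : Finset ℕ) :
    (digitMeasure p).map S.restrict =
      ((p : ℝ≥0∞) ^ S.card)⁻¹ • (Measure.count : Measure (S → Fin p)) := by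
  refine Measure.ext_of_singleton fun b => ?_
  rw [Measure.map_apply (Finset.measurable_restrict S) (measurableSet_singleton b)]
  refine (digitMeasure_restrict_eq S b).trans ?_
  simp

/-- The uniform measure on `C(I_n)` is the law of the `n`-th partial sum of the random series. -/
theorem cantorApprox_eq_map (hp : 2 ≤ p) (I : Set ℕ) (n : ℕ) :
    (cantorApprox p hp I n : Measure ℝ) =
      (digitMeasure p).map (digitSum (initialPart I n : Set ℕ)) := by
  have : NeZero p := ⟨by omega⟩
  have hm : Measurable (cantorPoint (p := p) (S := initialPart I n)) := measurable_of_finite _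
  have h1 : digitSum (p := p) (initialPart I n : Set ℕ) =
      cantorPoint ∘ (initialPart I n).restrict := funext fun ω => digitSum_coe _ ω
  rw [h1, ← Measure.map_map hm (Finset.measurable_restrict _), map_restrict_digitMeasure,
    Measure.map_smul]
  change ProbabilityTheory.uniformOn (cantorPart p I n) = _
  rw [cantorPart_eq]
  ext A hA
  have hfin : (range (cantorPoint (p := p) (S := initialPart I n))).Finite := finite_range _
  have h2 : Measure.count (range (cantorPoint (p := p) (S := initialPart I n))) =
      (p : ℝ≥0∞) ^ (initialPart I n).card := by
    rw [← image_univ, Measure.count_injective_image cantorPoint_injective, Measure.count_univ]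
    simp
  rw [ProbabilityTheory.uniformOn, ProbabilityTheory.cond_apply hfin.measurableSet, h2,
    Measure.smul_apply, Measure.map_apply hm hA, smul_eq_mul, inter_comm,
    ← image_preimage_eq_inter_range, Measure.count_injective_image cantorPoint_injective]

theorem tendsto_cantorApprox (hp : 2 ≤ p) (I : Set ℕ) :
    Tendsto (cantorApprox p hp I) atTop (𝓝 (cantorProb p hp I)) := by
  have : NeZero p := ⟨by omega⟩
  rw [ProbabilityMeasure.tendsto_iff_forall_integral_tendsto]
  intro f
  have h1 : ∀ J : Set ℕ, ∫ x, f x ∂((digitMeasure p).map (digitSum J)) =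
      ∫ ω, f (digitSum J ω) ∂digitMeasure p := fun J =>
    integral_map (measurable_digitSum hp J).aemeasurable
      f.continuous.aestronglyMeasurable
  simp only [cantorApprox_eq_map, coe_cantorProb, cantorMeasure, h1]
  refine tendsto_integral_of_dominated_convergence (fun _ => ‖f‖)
    (fun n => (f.continuous.measurable.comp (measurable_digitSum hp _)).aestronglyMeasurable)
    (integrable_const _) (fun n => ae_of_all _ fun ω => f.norm_coe_le_norm _)
    (ae_of_all _ fun ω => (f.continuous.tendsto _).comp (tendsto_digitSum_initialPart hp I ω))

/-- The union of the intervals of length `p^{-m}` to the right of the points of `C(I_m)`. -/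
def cantorCover (p : ℕ) (I : Set ℕ) (m : ℕ) : Set ℝ :=
  ⋃ b : initialPart I m → Fin p, Icc (cantorPoint b) (cantorPoint b + ((p : ℝ) ^ m)⁻¹)

theorem digitSum_mem_cantorCover (hp : 2 ≤ p) (I : Set ℕ) (m : ℕ) (ω : ℕ → Fin p) :
    digitSum (I ∩ Ioi 0) ω ∈ cantorCover p I m := by
  rw [digitSum_eq_add hp I m, digitSum_coe]
  exact mem_iUnion.2 ⟨_, by linarith [digitSum_nonneg (I ∩ Ioi m) ω],
    by linarith [digitSum_tail_le hp I m ω]⟩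

theorem isCompact_cantorCover (p : ℕ) (I : Set ℕ) (m : ℕ) : IsCompact (cantorCover p I m) :=
  isCompact_iUnion fun _ => isCompact_Icc

theorem cantorMeasure_compl_cantorCover (hp : 2 ≤ p) (I : Set ℕ) (m : ℕ) :
    cantorMeasure p I (cantorCover p I m)ᶜ = 0 := by
  rw [cantorMeasure_apply hp I (isCompact_cantorCover p I m).measurableSet.compl]
  simp [digitSum_mem_cantorCover hp I m]

theorem support_cantorMeasure_subset (hp : 2 ≤ p) (I : Set ℕ) (m : ℕ) :
    (cantorMeasure p I).support ⊆ cantorCover p I m :=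
  Measure.support_subset_of_isClosed (isCompact_cantorCover p I m).isClosed
    (mem_ae_iff.2 (cantorMeasure_compl_cantorCover hp I m))

theorem isCompact_support_cantorMeasure (hp : 2 ≤ p) (I : Set ℕ) :
    IsCompact (cantorMeasure p I).support :=
  (isCompact_cantorCover p I 0).of_isClosed_subset Measure.isClosed_support
    (support_cantorMeasure_subset hp I 0)

/-- An interval at scale `p^{-m}` has mass at most a constant times `p^{-#I_m}`. -/
theorem cantorMeasure_Icc_le (hp : 2 ≤ p) (I : Set ℕ) (m : ℕ) (x : ℝ) :
    cantorMeasure p I (Icc (x - ((p : ℝ) ^ m)⁻¹) (x + ((p : ℝ) ^ m)⁻¹)) ≤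
      4 * ((p : ℝ≥0∞) ^ (initialPart I m).card)⁻¹ := by
  classical
  have : NeZero p := ⟨by omega⟩
  have hp0 : (0 : ℝ) < (p : ℝ) ^ m := by
    have : 0 < p := by omega
    positivity
  rw [cantorMeasure_apply hp I measurableSet_Icc]
  set S := initialPart I m with hS
  set u : ℝ := x * (p : ℝ) ^ m with hu
  set B : Finset (S → Fin p) := Finset.univ.filter fun b =>
    u - 2 ≤ cantorPoint b * (p : ℝ) ^ m ∧ cantorPoint b * (p : ℝ) ^ m ≤ u + 1 with hB
  have hcover : {ω : ℕ → Fin p | digitSum (I ∩ Ioi 0) ω ∈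
      Icc (x - ((p : ℝ) ^ m)⁻¹) (x + ((p : ℝ) ^ m)⁻¹)} ⊆
      ⋃ b ∈ B, {ω | S.restrict ω = b} := by
    intro ω hω
    rw [mem_ofPred_eq, digitSum_eq_add hp I m, digitSum_coe] at hω
    obtain ⟨h1, h2⟩ := hω
    have h3 := digitSum_tail_le hp I m ω
    have h4 := digitSum_nonneg (I ∩ Ioi m) ω
    have h5 : ((p : ℝ) ^ m)⁻¹ * (p : ℝ) ^ m = 1 := inv_mul_cancel₀ hp0.ne'
    simp only [mem_iUnion, mem_ofPred_eq]
    refine ⟨S.restrict ω, ?_, rfl⟩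
    rw [hB, Finset.mem_filter]
    refine ⟨Finset.mem_univ _, ?_, ?_⟩
    · have : (x - 2 * ((p : ℝ) ^ m)⁻¹) * (p : ℝ) ^ m ≤
          cantorPoint (S.restrict ω) * (p : ℝ) ^ m := by gcongr; linarith
      linarith
    · have : cantorPoint (S.restrict ω) * (p : ℝ) ^ m ≤ (x + ((p : ℝ) ^ m)⁻¹) * (p : ℝ) ^ m := by
        gcongr
        linarith
      linarith
  have hcard : B.card ≤ 4 := by
    have hle : ∀ i ∈ S, i ≤ m := fun i hi => (mem_initialPart.1 hi).2.1
    have h1 : B.card ≤ (Finset.Icc ⌈u - 2⌉ ⌊u + 1⌋).card := by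
      refine Finset.card_le_card_of_injOn
        (fun b => ∑ i : S, ((b i : ℕ) : ℤ) * (p : ℤ) ^ (m - (i : ℕ))) (fun b hb => ?_) ?_
      · have hb' := (Finset.mem_filter.1 hb).2
        rw [exists_int_cantorPoint (by omega) hle b] at hb'
        simp only [Finset.coe_Icc, mem_Icc]
        exact ⟨Int.ceil_le.2 hb'.1, Int.le_floor.2 hb'.2⟩
      · intro b _ b' _ hbb
        refine cantorPoint_injective (mul_right_cancel₀ hp0.ne' ?_)
        rw [exists_int_cantorPoint (by omega) hle b, exists_int_cantorPoint (by omega) hle b']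
        exact congrArg _ hbb
    refine h1.trans ?_
    rw [Int.card_Icc, Int.toNat_le]
    have h2 : (⌊u + 1⌋ : ℝ) - ⌈u - 2⌉ ≤ 3 := by
      linarith [Int.floor_le (u + 1), Int.le_ceil (u - 2)]
    have h3 : ⌊u + 1⌋ - ⌈u - 2⌉ ≤ 3 := by exact_mod_cast h2
    push_cast
    omega
  calc _ ≤ _ := measure_mono hcover
    _ ≤ ∑ b ∈ B, digitMeasure p {ω | S.restrict ω = b} := measure_biUnion_finset_le _ _
    _ = B.card * ((p : ℝ≥0∞) ^ S.card)⁻¹ := by simp [digitMeasure_restrict_eq]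
    _ ≤ _ := by
      gcongr
      exact_mod_cast hcard

/-! ### Densities and thresholds -/

theorem eventually_card_le {I : Set ℕ} {t : ℝ≥0} (h : upperDensity I < t) :
    ∀ᶠ m : ℕ in atTop, ((initialPart I m).card : ℝ) ≤ t * m := by
  filter_upwards [eventually_lt_of_limsup_lt h, eventually_gt_atTop 0] with m hm hm0
  have h0 : (m : ℝ≥0∞) ≠ 0 := by exact_mod_cast hm0.ne'
  have := (ENNReal.div_le_iff h0 (ENNReal.natCast_ne_top m)).1 hm.le
  exact_mod_cast this

theorem frequently_le_card {I : Set ℕ} {t : ℝ≥0} (h : (t : ℝ≥0∞) < upperDensity I) :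
    ∃ᶠ m : ℕ in atTop, t * m ≤ ((initialPart I m).card : ℝ) := by
  refine ((frequently_lt_of_lt_limsup (by isBoundedDefault) h).and_eventually
    (eventually_gt_atTop 0)).mono fun m ⟨hm, hm0⟩ => ?_
  have h0 : (m : ℝ≥0∞) ≠ 0 := by exact_mod_cast hm0.ne'
  have := (ENNReal.le_div_iff_mul_le (Or.inl h0) (Or.inl (ENNReal.natCast_ne_top m))).1 hm.le
  exact_mod_cast this

theorem eventually_le_card {I : Set ℕ} {t : ℝ≥0} (h : (t : ℝ≥0∞) < lowerDensity I) :
    ∀ᶠ m : ℕ in atTop, t * m ≤ ((initialPart I m).card : ℝ) := by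
  filter_upwards [eventually_lt_of_lt_liminf h, eventually_gt_atTop 0] with m hm hm0
  have h0 : (m : ℝ≥0∞) ≠ 0 := by exact_mod_cast hm0.ne'
  have := (ENNReal.le_div_iff_mul_le (Or.inl h0) (Or.inl (ENNReal.natCast_ne_top m))).1 hm.le
  exact_mod_cast this

theorem frequently_card_le {I : Set ℕ} {t : ℝ≥0} (h : lowerDensity I < t) :
    ∃ᶠ m : ℕ in atTop, ((initialPart I m).card : ℝ) ≤ t * m := by
  refine ((frequently_lt_of_liminf_lt (by isBoundedDefault) h).and_eventually
    (eventually_gt_atTop 0)).mono fun m ⟨hm, hm0⟩ => ?_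
  have h0 : (m : ℝ≥0∞) ≠ 0 := by exact_mod_cast hm0.ne'
  have := (ENNReal.div_le_iff h0 (ENNReal.natCast_ne_top m)).1 hm.le
  exact_mod_cast this

theorem le_of_forall_lt_nnreal {a b : ℝ≥0∞} (h : ∀ t : ℝ≥0, b < t → a ≤ t) : a ≤ b := by
  by_contra! hlt
  obtain ⟨t, h1, h2⟩ := ENNReal.lt_iff_exists_nnreal_btwn.1 hlt
  exact absurd (h t h1) (not_le.2 h2)

/-! ### Hausdorff dimension -/

theorem cantorMeasure_le_of_ediam_le (hp : 2 ≤ p) {I : Set ℕ} {m : ℕ} {t : ℝ≥0}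
    (ht : t * m ≤ ((initialPart I m).card : ℝ)) {s : Set ℝ}
    (hs : Metric.ediam s ≤ ENNReal.ofReal ((p : ℝ) ^ m)⁻¹) :
    cantorMeasure p I s ≤ ENNReal.ofReal (4 * (((p : ℝ) ^ m)⁻¹) ^ (t : ℝ)) := by
  rcases s.eq_empty_or_nonempty with rfl | ⟨x, hx⟩
  · simp
  have hp1 : (1 : ℝ) ≤ p := by
    have : 1 ≤ p := by omega
    exact_mod_cast this
  have hsub : s ⊆ Icc (x - ((p : ℝ) ^ m)⁻¹) (x + ((p : ℝ) ^ m)⁻¹) := by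
    intro y hy
    have h1 := (Metric.edist_le_ediam_of_mem hy hx).trans hs
    rw [edist_dist, ENNReal.ofReal_le_ofReal_iff (by positivity), Real.dist_eq, abs_le] at h1
    exact ⟨by linarith [h1.1], by linarith [h1.2]⟩
  refine (measure_mono hsub).trans ((cantorMeasure_Icc_le hp I m x).trans ?_)
  rw [ENNReal.ofReal_mul (by norm_num), Real.inv_rpow (by positivity),
    ENNReal.ofReal_inv_of_pos (by positivity)]
  have h2 : ((p : ℝ) ^ m) ^ (t : ℝ) ≤ (p : ℝ) ^ (initialPart I m).card := by
    rw [← Real.rpow_natCast, ← Real.rpow_mul (by positivity), ← Real.rpow_natCast]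
    exact Real.rpow_le_rpow_of_exponent_le hp1 (by linarith)
  have h3 : (p : ℝ≥0∞) ^ (initialPart I m).card =
      ENNReal.ofReal ((p : ℝ) ^ (initialPart I m).card) := by
    rw [ENNReal.ofReal_pow (by positivity), ENNReal.ofReal_natCast]
  rw [h3]
  gcongr
  simp

/-- Sets of positive measure have Hausdorff dimension at least `liminf #I_n / n`, by the mass
distribution principle. -/
theorem lowerDensity_le_dimH (hp : 2 ≤ p) {I : Set ℕ} {A : Set ℝ}
    (hA : 0 < cantorMeasure p I A) : lowerDensity I ≤ dimH A := by
  refine ENNReal.le_of_forall_nnreal_lt fun t ht => ?_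
  rcases eq_or_ne t 0 with rfl | ht0
  · simp
  have ht0' : (0 : ℝ) < t := by positivity
  have hp1 : (1 : ℝ) < p := by exact_mod_cast hp
  obtain ⟨M, hM⟩ := eventually_atTop.1 (eventually_le_card ht)
  set C : ℝ := 4 * (p : ℝ) ^ (t : ℝ) with hC
  have hC0 : 0 < C := by positivity
  -- at a diameter between two powers of `p`, the factor `p^t` in `C` pays for the rounding
  have key : ENNReal.ofReal C⁻¹ • cantorMeasure p I ≤ μH[(t : ℝ)] := by
    refine Measure.le_hausdorffMeasure _ _ (ENNReal.ofReal ((p : ℝ) ^ M)⁻¹)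
      (by simp only [ENNReal.ofReal_pos]; positivity) fun s hs => ?_
    have hfin : Metric.ediam s ≠ ∞ := ne_top_of_le_ne_top ENNReal.ofReal_ne_top hs
    rw [Measure.smul_apply, smul_eq_mul]
    set d := (Metric.ediam s).toReal with hd
    have hdd : Metric.ediam s = ENNReal.ofReal d := (ENNReal.ofReal_toReal hfin).symm
    rcases (show 0 ≤ d from ENNReal.toReal_nonneg).eq_or_lt with h0 | h0
    · -- a set of diameter zero is null, as it fits into intervals of every scale
      have h1 : cantorMeasure p I s ≤ 0 := by
        have h2 : Tendsto (fun m => ENNReal.ofReal (4 * (((p : ℝ) ^ m)⁻¹) ^ (t : ℝ))) atTop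
            (𝓝 0) := by
          rw [← ENNReal.ofReal_zero]
          refine ENNReal.tendsto_ofReal ?_
          have := ((tendsto_inv_pow hp).rpow_const (Or.inr ht0'.le)).const_mul 4
          rwa [Real.zero_rpow ht0'.ne', mul_zero] at this
        refine ge_of_tendsto h2 (eventually_atTop.2 ⟨M, fun m hm => ?_⟩)
        exact cantorMeasure_le_of_ediam_le hp (hM m hm) (by
          rw [hdd, ← h0, ENNReal.ofReal_zero]
          exact zero_le)
      simp [nonpos_iff_eq_zero.1 h1]
    · have hdM : d ≤ ((p : ℝ) ^ M)⁻¹ := by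
        rwa [hdd, ENNReal.ofReal_le_ofReal_iff (by positivity)] at hs
      have hd1 : d ≤ 1 := hdM.trans (inv_le_one_of_one_le₀ (one_le_pow₀ hp1.le))
      obtain ⟨m, hm1, hm2⟩ := exists_nat_pow_near_of_lt_one h0 hd1
        (inv_pos.2 (by linarith : (0 : ℝ) < p)) (inv_lt_one_of_one_lt₀ hp1)
      rw [inv_pow] at hm1 hm2
      have hmM : M ≤ m := by
        have h1 := (inv_lt_inv₀ (by positivity) (by positivity)).1 (hm1.trans_le hdM)
        have := (pow_lt_pow_iff_right₀ hp1).1 h1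
        omega
      have h1 := cantorMeasure_le_of_ediam_le hp (hM m hmM) (s := s)
        (by rw [hdd]; exact ENNReal.ofReal_le_ofReal hm2)
      have h2 : 4 * (((p : ℝ) ^ m)⁻¹) ^ (t : ℝ) ≤ C * d ^ (t : ℝ) := by
        have h3 : ((p : ℝ) ^ m)⁻¹ = p * ((p : ℝ) ^ (m + 1))⁻¹ := by
          field_simp
          ring
        rw [h3, Real.mul_rpow (by positivity) (by positivity), hC, mul_assoc]
        gcongr
      calc _ ≤ ENNReal.ofReal C⁻¹ * ENNReal.ofReal (C * d ^ (t : ℝ)) := by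
            gcongr
            exact h1.trans (ENNReal.ofReal_le_ofReal h2)
        _ = _ := by
          rw [← ENNReal.ofReal_mul (by positivity), inv_mul_cancel_left₀ hC0.ne', hdd,
            ENNReal.ofReal_rpow_of_pos h0]
  refine le_dimH_of_hausdorffMeasure_ne_zero fun h0 => ?_
  have h1 := key A
  rw [h0, Measure.smul_apply, smul_eq_mul, nonpos_iff_eq_zero, mul_eq_zero] at h1
  rcases h1 with h1 | h1
  · rw [ENNReal.ofReal_eq_zero] at h1
    exact absurd h1 (not_le.2 (by positivity))
  · exact hA.ne' h1

/-- The coverings of the support at those scales where `#I_m / m` is close to its lower limit. -/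
theorem dimH_support_le (hp : 2 ≤ p) (I : Set ℕ) :
    dimH (cantorMeasure p I).support ≤ lowerDensity I := by
  refine le_of_forall_lt_nnreal fun t ht => ?_
  have hp1 : (1 : ℝ) < p := by exact_mod_cast hp
  have hfreq := frequently_card_le ht
  -- the scales `p^{-m}` with `#I_m ≤ t m`
  set l : Filter ℕ := atTop ⊓ 𝓟 {m | ((initialPart I m).card : ℝ) ≤ t * m} with hl
  have : l.NeBot := frequently_mem_iff_neBot.1 hfreq
  have hle : μH[(t : ℝ)] (cantorMeasure p I).support ≤ 1 := by
    refine (Measure.hausdorffMeasure_le_liminf_sum (t : ℝ) _ (l := l)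
      (ι := fun m => initialPart I m → Fin p)
      (fun m => ENNReal.ofReal ((p : ℝ) ^ m)⁻¹) ?_
      (fun m b => Icc (cantorPoint b) (cantorPoint b + ((p : ℝ) ^ m)⁻¹)) ?_ ?_).trans ?_
    · have := ENNReal.tendsto_ofReal ((tendsto_inv_pow hp).mono_left (inf_le_left : l ≤ atTop))
      rwa [ENNReal.ofReal_zero] at this
    · refine Eventually.of_forall fun m b => ?_
      simp [Real.ediam_Icc]
    · exact Eventually.of_forall fun m => support_cantorMeasure_subset hp I m
    · refine liminf_le_of_frequently_le' (Eventually.frequently ?_)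
      have hmem : {m | ((initialPart I m).card : ℝ) ≤ t * m} ∈ l :=
        mem_inf_of_right (mem_principal_self _)
      filter_upwards [hmem] with m hm
      have hm : ((initialPart I m).card : ℝ) ≤ t * m := hm
      simp only [Real.ediam_Icc, add_sub_cancel_left, Finset.sum_const, Finset.card_univ,
        Fintype.card_fun, Fintype.card_fin, Fintype.card_coe, nsmul_eq_mul]
      rw [ENNReal.ofReal_rpow_of_pos (by positivity), ← ENNReal.ofReal_natCast,
        ← ENNReal.ofReal_mul (by positivity), ENNReal.ofReal_le_one, Real.inv_rpow (by positivity)]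
      rw [mul_inv_le_iff₀ (by positivity), one_mul]
      push_cast
      rw [← Real.rpow_natCast, ← Real.rpow_natCast (p : ℝ) m, ← Real.rpow_mul (by positivity)]
      exact Real.rpow_le_rpow_of_exponent_le hp1.le (by linarith)
  exact dimH_le_of_hausdorffMeasure_ne_top (ne_top_of_le_ne_top ENNReal.one_ne_top hle)

theorem lowerHausdorffDim_le_upperHausdorffDim (μ : Measure ℝ) [IsProbabilityMeasure μ] :
    lowerHausdorffDim μ ≤ upperHausdorffDim μ :=
  le_iInf₂ fun A hA => le_iInf fun h1 => iInf₂_le_of_le A hA (iInf_le_of_le (by simp [h1]) le_rfl)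

theorem upperHausdorffDim_le_dimH_support (μ : Measure ℝ) [IsProbabilityMeasure μ] :
    upperHausdorffDim μ ≤ dimH μ.support :=
  iInf₂_le_of_le _ Measure.isClosed_support.measurableSet
    (iInf_le_of_le ((prob_compl_eq_zero_iff Measure.isClosed_support.measurableSet).1
      Measure.measure_compl_support) le_rfl)

theorem lowerHausdorffDim_condOn_ge (ν : ProbabilityMeasure ℝ) (K : RestrictionSet ν) :
    lowerHausdorffDim (ν : Measure ℝ) ≤ lowerHausdorffDim (condOn ν K.1) := by
  refine le_iInf₂ fun A hA => le_iInf fun h => iInf₂_le_of_le A hA (iInf_le_of_le ?_ le_rfl)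
  exact pos_iff_ne_zero.2 fun h0 => h.ne' (ProbabilityTheory.cond_absolutelyContinuous h0)

theorem condOn_univ (ν : ProbabilityMeasure ℝ) : condOn ν univ = (ν : Measure ℝ) :=
  ProbabilityTheory.cond_univ _

/-- The whole line as one of the sets over which restrictions are taken. -/
def RestrictionSet.whole (ν : ProbabilityMeasure ℝ) : RestrictionSet ν :=
  ⟨univ, by simp, by simp⟩

/-! ### Entropy dimension -/

theorem mem_dyadic_iff {n : ℕ} {k : ℤ} {x : ℝ} :
    x ∈ Ico ((k : ℝ) / 2 ^ n) (((k : ℝ) + 1) / 2 ^ n) ↔ ⌊x * 2 ^ n⌋ = k := by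
  rw [mem_Ico, div_le_iff₀ (by positivity), lt_div_iff₀ (by positivity), Int.floor_eq_iff]

theorem tsum_measure_dyadic (μ : Measure ℝ) (n : ℕ) :
    ∑' k : ℤ, μ (Ico ((k : ℝ) / 2 ^ n) (((k : ℝ) + 1) / 2 ^ n)) = μ univ := by
  rw [← measure_iUnion _ fun _ => measurableSet_Ico]
  · congr 1
    exact eq_univ_of_forall fun x => mem_iUnion.2 ⟨_, mem_dyadic_iff.2 rfl⟩
  · intro k l hkl
    refine Set.disjoint_left.2 fun x hx hx' => hkl ?_
    rw [← mem_dyadic_iff.1 hx, ← mem_dyadic_iff.1 hx']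

/-- If all dyadic intervals of order `n` have mass at most `2^{-M}`, the entropy is at least
`M`. -/
theorem le_dyadicEntropy (μ : Measure ℝ) [IsProbabilityMeasure μ] (n : ℕ) (M : ℝ)
    (h : ∀ k : ℤ, μ.real (Ico ((k : ℝ) / 2 ^ n) (((k : ℝ) + 1) / 2 ^ n)) ≤ (2 : ℝ) ^ (-M)) :
    ENNReal.ofReal M ≤ dyadicEntropy μ n := by
  have h1 := tsum_measure_dyadic μ n
  rw [measure_univ] at h1
  rw [← one_mul (ENNReal.ofReal M), ← h1, ← ENNReal.tsum_mul_right, dyadicEntropy]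
  refine ENNReal.tsum_le_tsum fun k => ?_
  have hk := h k
  rw [← ofReal_measureReal, ← ENNReal.ofReal_mul measureReal_nonneg]
  set q := μ.real (Ico ((k : ℝ) / 2 ^ n) (((k : ℝ) + 1) / 2 ^ n)) with hq
  refine ENNReal.ofReal_le_ofReal ?_
  have hq0 : 0 ≤ q := measureReal_nonneg
  rcases hq0.eq_or_lt with h0 | h0
  · simp [← h0]
  · have : Real.logb 2 q ≤ -M := by
      rw [Real.logb_le_iff_le_rpow one_lt_two h0]
      exact hk
    rw [← mul_neg]
    gcongr
    linarith

/-- If the mass is carried by at most `M` dyadic intervals of order `n`, the entropy is at most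
`log₂ M`. This is Jensen's inequality for `log`, proved from `log x ≤ x - 1`. -/
theorem dyadicEntropy_le (μ : Measure ℝ) [IsProbabilityMeasure μ] (n : ℕ) (F : Finset ℤ) (M : ℝ)
    (hM : 0 < M) (hF : (F.card : ℝ) ≤ M)
    (h : ∀ k ∉ F, μ (Ico ((k : ℝ) / 2 ^ n) (((k : ℝ) + 1) / 2 ^ n)) = 0) :
    dyadicEntropy μ n ≤ ENNReal.ofReal (Real.logb 2 M) := by
  have h1 := tsum_measure_dyadic μ n
  rw [measure_univ, tsum_eq_sum (s := F) fun k hk => h k hk] at h1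
  set q : ℤ → ℝ := fun k => μ.real (Ico ((k : ℝ) / 2 ^ n) (((k : ℝ) + 1) / 2 ^ n)) with hq
  have hq0 : ∀ k, 0 ≤ q k := fun k => measureReal_nonneg
  have hq1 : ∀ k, q k ≤ 1 := fun k => measureReal_le_one
  have hsum : ∑ k ∈ F, q k = 1 := by
    rw [hq]
    simp only [Measure.real]
    rw [← ENNReal.toReal_sum fun k _ => measure_ne_top _ _, h1, ENNReal.toReal_one]
  rw [dyadicEntropy, tsum_eq_sum (s := F) fun k hk => by simp [Measure.real, h k hk],
    ← ENNReal.ofReal_sum_of_nonneg]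
  · refine ENNReal.ofReal_le_ofReal ?_
    have hlog : 0 < Real.log 2 := Real.log_pos one_lt_two
    have hterm : ∀ k ∈ F, -(q k * Real.log (q k)) ≤ q k * Real.log M + (M⁻¹ - q k) := by
      intro k _
      rcases (hq0 k).eq_or_lt with h0 | h0
      · simp only [← h0]
        simp [hM.le]
      · have h2 := Real.log_le_sub_one_of_pos (x := (q k * M)⁻¹) (by positivity)
        rw [Real.log_inv, Real.log_mul h0.ne' hM.ne'] at h2
        have h3 := mul_le_mul_of_nonneg_left h2 h0.le
        have h4 : q k * ((q k * M)⁻¹ - 1) = M⁻¹ - q k := by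
          field_simp
        linarith
    have h5 := Finset.sum_le_sum hterm
    rw [Finset.sum_add_distrib, ← Finset.sum_mul, Finset.sum_sub_distrib, hsum,
      Finset.sum_const, nsmul_eq_mul] at h5
    have h6 : (F.card : ℝ) * M⁻¹ ≤ 1 := by
      rw [mul_inv_le_iff₀ hM]
      linarith
    have h7 : ∑ k ∈ F, -(q k * Real.logb 2 (q k)) =
        (∑ k ∈ F, -(q k * Real.log (q k))) / Real.log 2 := by
      rw [Finset.sum_div]
      refine Finset.sum_congr rfl fun k _ => ?_
      rw [Real.logb]
      ring
    change ∑ k ∈ F, -(q k * Real.logb 2 (q k)) ≤ _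
    rw [h7, Real.logb]
    gcongr
    linarith
  · intro k _
    have := Real.logb_nonpos one_lt_two (hq0 k) (hq1 k)
    exact neg_nonneg.2 (mul_nonpos_of_nonneg_of_nonpos (hq0 k) this)

/-- Entropy from below, for every probability measure with bounded density with respect to the
Cantor-type measure. -/
theorem upperDensity_le_upperEntropyDim (hp : 2 ≤ p) (I : Set ℕ) (μ : Measure ℝ)
    [IsProbabilityMeasure μ] {c : ℝ} (hc : 0 < c)
    (hμ : ∀ s, MeasurableSet s → μ s ≤ ENNReal.ofReal c * cantorMeasure p I s) :
    upperDensity I ≤ upperEntropyDim μ := by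
  refine ENNReal.le_of_forall_nnreal_lt fun t' ht' => ?_
  obtain ⟨t, ht1, ht2⟩ := ENNReal.lt_iff_exists_nnreal_btwn.1 ht'
  have htt : (t' : ℝ) < t := by exact_mod_cast ht1
  have hp1 : (1 : ℝ) < p := by exact_mod_cast hp
  set C : ℝ := t + Real.logb 2 (4 * c) with hC
  -- to the scale `p^{-m}` corresponds the least `n` with `2^{-n} ≤ p^{-m}`
  have htend : Tendsto (fun m => Nat.clog 2 (p ^ m)) atTop atTop := by
    refine tendsto_atTop_mono (fun m => ?_) tendsto_id
    have h1 : 2 ^ m ≤ 2 ^ Nat.clog 2 (p ^ m) :=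
      (Nat.pow_le_pow_left hp m).trans (Nat.le_pow_clog one_lt_two _)
    exact (Nat.pow_le_pow_iff_right one_lt_two).1 h1
  have hfreq : ∃ᶠ n : ℕ in atTop, ENNReal.ofReal (t * n - C) ≤ dyadicEntropy μ n := by
    refine htend.frequently (((frequently_le_card ht2).and_eventually
      (eventually_gt_atTop 0)).mono fun m ⟨hm, hm0⟩ => ?_)
    set n := Nat.clog 2 (p ^ m) with hn
    have hpm : 1 < p ^ m := Nat.one_lt_pow hm0.ne' (by omega)
    have h1 : (p : ℝ) ^ m ≤ 2 ^ n := by exact_mod_cast Nat.le_pow_clog one_lt_two (p ^ m)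
    have h2 : (2 : ℝ) ^ ((n : ℝ) - 1) ≤ (p : ℝ) ^ m := by
      have h3 : 2 ^ (n - 1) < p ^ m := Nat.pow_pred_clog_lt_self one_lt_two hpm
      have h4 : 0 < n := Nat.clog_pos one_lt_two hpm
      have h5 : (n : ℝ) - 1 = ((n - 1 : ℕ) : ℝ) := by
        rw [Nat.cast_sub (by omega)]
        simp
      rw [h5, Real.rpow_natCast]
      exact_mod_cast h3.le
    refine le_dyadicEntropy μ n _ fun k => ?_
    have hsub : Ico ((k : ℝ) / 2 ^ n) (((k : ℝ) + 1) / 2 ^ n) ⊆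
        Icc ((k : ℝ) / 2 ^ n - ((p : ℝ) ^ m)⁻¹) ((k : ℝ) / 2 ^ n + ((p : ℝ) ^ m)⁻¹) := by
      intro x hx
      have h3 : ((2 : ℝ) ^ n)⁻¹ ≤ ((p : ℝ) ^ m)⁻¹ := by gcongr
      have h4 : 0 < ((p : ℝ) ^ m)⁻¹ := by positivity
      rw [mem_Ico, add_div, one_div] at hx
      exact ⟨by linarith [hx.1], by linarith [hx.2]⟩
    have h3 : μ (Ico ((k : ℝ) / 2 ^ n) (((k : ℝ) + 1) / 2 ^ n)) ≤
        ENNReal.ofReal (c * (4 * ((p : ℝ) ^ (initialPart I m).card)⁻¹)) := by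
      refine (hμ _ measurableSet_Ico).trans ?_
      rw [ENNReal.ofReal_mul hc.le, ENNReal.ofReal_mul (by norm_num),
        ENNReal.ofReal_inv_of_pos (by positivity), ENNReal.ofReal_pow (by positivity),
        ENNReal.ofReal_natCast]
      gcongr
      exact (measure_mono hsub).trans ((cantorMeasure_Icc_le hp I m _).trans (by simp))
    have h4 : μ.real (Ico ((k : ℝ) / 2 ^ n) (((k : ℝ) + 1) / 2 ^ n)) ≤
        c * (4 * ((p : ℝ) ^ (initialPart I m).card)⁻¹) :=
      ENNReal.toReal_le_of_le_ofReal (by positivity) h3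
    refine h4.trans ?_
    have h5 : (2 : ℝ) ^ (t * ((n : ℝ) - 1)) ≤ (p : ℝ) ^ (initialPart I m).card := by
      rw [mul_comm, Real.rpow_mul (by norm_num)]
      calc ((2 : ℝ) ^ ((n : ℝ) - 1)) ^ (t : ℝ) ≤ ((p : ℝ) ^ m) ^ (t : ℝ) := by gcongr
        _ = (p : ℝ) ^ (t * m : ℝ) := by
          rw [← Real.rpow_natCast, ← Real.rpow_mul (by positivity), mul_comm]
        _ ≤ (p : ℝ) ^ ((initialPart I m).card : ℝ) :=
          Real.rpow_le_rpow_of_exponent_le hp1.le hm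
        _ = _ := Real.rpow_natCast _ _
    have h6 : (2 : ℝ) ^ (-((t : ℝ) * n - C)) = 4 * c * ((2 : ℝ) ^ (t * ((n : ℝ) - 1)))⁻¹ := by
      have h7 : -((t : ℝ) * n - C) = Real.logb 2 (4 * c) + -(t * ((n : ℝ) - 1)) := by
        rw [hC]
        ring
      rw [h7, Real.rpow_add (by norm_num), Real.rpow_logb (by norm_num) (by norm_num)
        (by positivity), Real.rpow_neg (by norm_num)]
    rw [h6, ← mul_assoc, mul_comm c 4]
    gcongr
  refine le_limsup_of_frequently_le' ?_
  have hev : ∀ᶠ n : ℕ in atTop, C ≤ (t - t') * n :=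
    (tendsto_natCast_atTop_atTop.const_mul_atTop (sub_pos.2 htt)).eventually_ge_atTop C
  refine (hfreq.and_eventually (hev.and (eventually_gt_atTop 0))).mono fun n ⟨h1, h2, h3⟩ => ?_
  have h0 : (n : ℝ≥0∞) ≠ 0 := by exact_mod_cast h3.ne'
  rw [ENNReal.le_div_iff_mul_le (Or.inl h0) (Or.inl (ENNReal.natCast_ne_top n))]
  refine le_trans ?_ h1
  rw [← ENNReal.ofReal_coe_nnreal, ← ENNReal.ofReal_natCast n, ← ENNReal.ofReal_mul t'.coe_nonneg]
  exact ENNReal.ofReal_le_ofReal (by linarith)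

theorem upperEntropyDim_cantorMeasure_le (hp : 2 ≤ p) (I : Set ℕ)
    [IsProbabilityMeasure (cantorMeasure p I)] :
    upperEntropyDim (cantorMeasure p I) ≤ upperDensity I := by
  refine le_of_forall_lt_nnreal fun t' ht' => ?_
  obtain ⟨t, ht1, ht2⟩ := ENNReal.lt_iff_exists_nnreal_btwn.1 ht'
  have htt : (t : ℝ) < t' := by exact_mod_cast ht2
  have hp1 : (1 : ℝ) < p := by exact_mod_cast hp
  set C : ℝ := Real.logb 2 (p + 1) with hC
  -- to the scale `2^{-n}` corresponds the largest `m` with `2^{-n} ≤ p^{-m}`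
  have htend : Tendsto (fun n => Nat.log p (2 ^ n)) atTop atTop := by
    refine tendsto_atTop.2 fun a => ?_
    filter_upwards [eventually_ge_atTop (p ^ a)] with n hn
    exact Nat.le_log_of_pow_le (by omega) (hn.trans Nat.lt_two_pow_self.le)
  have hbound : ∀ᶠ n : ℕ in atTop,
      dyadicEntropy (cantorMeasure p I) n ≤ ENNReal.ofReal (t * n + C) := by
    filter_upwards [htend.eventually (eventually_card_le ht1)] with n hcard
    set m := Nat.log p (2 ^ n) with hm
    have h1 : (p : ℝ) ^ m ≤ 2 ^ n := by
      exact_mod_cast Nat.pow_log_le_self p (by positivity : 2 ^ n ≠ 0)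
    have h2 : (2 : ℝ) ^ n < (p : ℝ) ^ (m + 1) := by
      exact_mod_cast Nat.lt_pow_succ_log_self (by omega : 1 < p) (2 ^ n)
    set F : Finset ℤ := Finset.univ.biUnion fun b : initialPart I m → Fin p =>
      Finset.Icc ⌊cantorPoint b * 2 ^ n⌋ (⌊cantorPoint b * 2 ^ n⌋ + p) with hF
    have hFcard : (F.card : ℝ) ≤ (p : ℝ) ^ (initialPart I m).card * (p + 1) := by
      have : F.card ≤ p ^ (initialPart I m).card * (p + 1) := by
        refine Finset.card_biUnion_le.trans (le_of_eq ?_)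
        have h3 : ∀ z : ℤ, (z + p + 1 - z).toNat = p + 1 := fun z => by omega
        simp [Int.card_Icc, h3]
      exact_mod_cast this
    refine (dyadicEntropy_le _ n F _ (by positivity) hFcard fun k hk => ?_).trans
      (ENNReal.ofReal_le_ofReal ?_)
    · refine measure_mono_null (t := (cantorCover p I m)ᶜ) (fun x hx hx' => hk ?_)
        (cantorMeasure_compl_cantorCover hp I m)
      obtain ⟨b, hb1, hb2⟩ := mem_iUnion.1 hx'
      rw [hF, Finset.mem_biUnion]
      refine ⟨b, Finset.mem_univ _, ?_⟩
      rw [Finset.mem_Icc, ← mem_dyadic_iff.1 hx]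
      refine ⟨Int.floor_le_floor (by gcongr), ?_⟩
      rw [← Int.floor_add_natCast]
      refine Int.floor_le_floor ?_
      have h3 : ((p : ℝ) ^ m)⁻¹ * 2 ^ n ≤ p := by
        rw [inv_mul_le_iff₀ (by positivity), ← pow_succ]
        exact h2.le
      calc x * 2 ^ n ≤ (cantorPoint b + ((p : ℝ) ^ m)⁻¹) * 2 ^ n := by gcongr
        _ ≤ _ := by linarith
    · rw [Real.logb_mul (by positivity) (by positivity), Real.logb_pow]
      have hlog : 0 ≤ Real.logb 2 p := Real.logb_nonneg one_lt_two hp1.le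
      have h4 : (m : ℝ) * Real.logb 2 p ≤ n := by
        have := Real.logb_le_logb_of_le one_lt_two (by positivity) h1
        rwa [Real.logb_pow, Real.logb_pow, Real.logb_self_eq_one one_lt_two, mul_one] at this
      have h5 : ((initialPart I m).card : ℝ) * Real.logb 2 p ≤ t * n :=
        calc _ ≤ (t * m : ℝ) * Real.logb 2 p := by gcongr
          _ = t * (m * Real.logb 2 p) := by ring
          _ ≤ _ := by gcongr
      linarith
  have hev : ∀ᶠ n : ℕ in atTop, C ≤ (t' - t) * n :=
    (tendsto_natCast_atTop_atTop.const_mul_atTop (sub_pos.2 htt)).eventually_ge_atTop C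
  refine limsup_le_of_le (by isBoundedDefault) ?_
  filter_upwards [hbound, hev, eventually_gt_atTop 0] with n h1 h2 h3
  have h0 : (n : ℝ≥0∞) ≠ 0 := by exact_mod_cast h3.ne'
  rw [ENNReal.div_le_iff h0 (ENNReal.natCast_ne_top n)]
  refine h1.trans ?_
  rw [← ENNReal.ofReal_coe_nnreal, ← ENNReal.ofReal_natCast n, ← ENNReal.ofReal_mul t'.coe_nonneg]
  exact ENNReal.ofReal_le_ofReal (by linarith)

/-- Restricting to a set of positive measure does not decrease the entropy dimension. -/
theorem upperDensity_le_upperEntropyDim_condOn (hp : 2 ≤ p) (I : Set ℕ)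
    (K : RestrictionSet (cantorProb p hp I)) :
    upperDensity I ≤ upperEntropyDim (condOn (cantorProb p hp I) K.1) := by
  have hK : 0 < cantorMeasure p I K.1 := K.2.1
  have := isProbabilityMeasure_cantorMeasure hp I
  refine upperDensity_le_upperEntropyDim hp I _ (c := (cantorMeasure p I K.1).toReal⁻¹)
    (inv_pos.2 (ENNReal.toReal_pos hK.ne' (measure_ne_top _ _))) fun s hs => ?_
  have hcond : condOn (cantorProb p hp I) K.1 s =
      (cantorMeasure p I K.1)⁻¹ * cantorMeasure p I (K.1 ∩ s) := ProbabilityTheory.cond_apply' hs _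
  rw [hcond, ENNReal.ofReal_inv_of_pos
    (ENNReal.toReal_pos hK.ne' (measure_ne_top _ _)), ENNReal.ofReal_toReal (measure_ne_top _ _)]
  gcongr
  exact inter_subset_right

/-! ### Beurling dimension -/

theorem spectrumPoint_restrict (S : Finset ℕ) (ω : ℕ → Fin p) :
    spectrumPoint (S.restrict ω) = ∑ i ∈ S, (ω i : ℕ) * p ^ (i - 1) := by
  rw [spectrumPoint, ← Finset.sum_coe_sort S]
  rfl

/-- Extending a digit string by zeros. -/
theorem exists_extend_digits [NeZero p] {S : Finset ℕ} (b : S → Fin p) :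
    ∃ ω : ℕ → Fin p, S.restrict ω = b ∧ ∀ i ∉ S, ω i = 0 := by
  classical
  refine ⟨fun i => if h : i ∈ S then b ⟨i, h⟩ else 0, ?_, fun i hi => by simp [hi]⟩
  ext i
  simp [Finset.restrict]

theorem exists_spectrumPoint_eq_of_subset [NeZero p] {S T : Finset ℕ} (h : S ⊆ T)
    (b : S → Fin p) : ∃ c : T → Fin p, spectrumPoint c = spectrumPoint b := by
  obtain ⟨ω, rfl, h0⟩ := exists_extend_digits b
  refine ⟨T.restrict ω, ?_⟩
  rw [spectrumPoint_restrict, spectrumPoint_restrict]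
  exact (Finset.sum_subset h fun i _ hi => by simp [h0 i hi]).symm

theorem spectrumPart_mono [NeZero p] (I : Set ℕ) : Monotone (spectrumPart p I) := by
  intro m n hmn
  rw [spectrumPart_eq, spectrumPart_eq]
  rintro _ ⟨b, rfl⟩
  obtain ⟨c, hc⟩ := exists_spectrumPoint_eq_of_subset (initialPart_mono I hmn) b
  exact ⟨c, by simp [hc]⟩

theorem exists_spectrumPoint_add [NeZero p] {I : Set ℕ} {x : ℝ} (hx : x ∈ cantorSpectrum p I)
    (m : ℕ) : ∃ (b : initialPart I m → Fin p) (q : ℕ), x = spectrumPoint b + (p : ℝ) ^ m * q := by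
  obtain ⟨n₀, hn₀⟩ := mem_iUnion.1 hx
  have hn := spectrumPart_mono I (le_max_left n₀ m) hn₀
  set n := max n₀ m with hn_def
  rw [spectrumPart_eq] at hn
  obtain ⟨b, rfl⟩ := hn
  obtain ⟨ω, rfl, -⟩ := exists_extend_digits b
  have hsub := initialPart_mono I (le_max_right n₀ m)
  have hdvd : p ^ m ∣ ∑ i ∈ initialPart I n \ initialPart I m, (ω i : ℕ) * p ^ (i - 1) := by
    refine Finset.dvd_sum fun i hi => Dvd.dvd.mul_left (pow_dvd_pow p ?_) _
    rw [Finset.mem_sdiff, mem_initialPart, mem_initialPart] at hi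
    have : ¬ i ≤ m := fun h => hi.2 ⟨hi.1.1, h, hi.1.2.2⟩
    omega
  obtain ⟨q, hq⟩ := hdvd
  refine ⟨(initialPart I m).restrict ω, q, ?_⟩
  change ((spectrumPoint ((initialPart I n).restrict ω) : ℕ) : ℝ) = _
  rw [spectrumPoint_restrict, spectrumPoint_restrict, ← Finset.sum_sdiff hsub, hq]
  push_cast
  ring

/-- A ball of radius at most `p^m` contains at most `3 p^{#I_m}` elements of the spectrum: the
last `m` digits of an element can be chosen in `p^{#I_m}` ways, and they determine it up to a
multiple of `p^m`. -/
theorem encard_cantorSpectrum_inter_ball_le (hp : 2 ≤ p) (I : Set ℕ) {m : ℕ} {x h : ℝ}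
    (hh : h ≤ (p : ℝ) ^ m) :
    (cantorSpectrum p I ∩ Metric.ball x h).encard ≤
      ((3 * p ^ (initialPart I m).card : ℕ) : ℕ∞) := by
  classical
  have : NeZero p := ⟨by omega⟩
  have hp0 : (0 : ℝ) < (p : ℝ) ^ m := by
    have : 0 < p := by omega
    positivity
  set u : (initialPart I m → Fin p) → ℝ := fun b => (x - spectrumPoint b) / (p : ℝ) ^ m with hu
  set F : Finset ℝ := Finset.univ.biUnion fun b : initialPart I m → Fin p =>
    (Finset.Icc ⌈u b - 1⌉ ⌊u b + 1⌋).image fun q : ℤ => (spectrumPoint b : ℝ) + (p : ℝ) ^ m * q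
    with hF
  have hsub : cantorSpectrum p I ∩ Metric.ball x h ⊆ F := by
    rintro y ⟨hy, hyx⟩
    obtain ⟨b, q, rfl⟩ := exists_spectrumPoint_add hy m
    rw [Metric.mem_ball, Real.dist_eq, abs_lt] at hyx
    rw [Finset.mem_coe, hF, Finset.mem_biUnion]
    refine ⟨b, Finset.mem_univ _, Finset.mem_image.2 ⟨(q : ℤ), ?_, by simp⟩⟩
    rw [Finset.mem_Icc, Int.ceil_le, Int.le_floor]
    push_cast
    have h1 : u b * (p : ℝ) ^ m = x - spectrumPoint b := div_mul_cancel₀ _ hp0.ne'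
    constructor
    · refine le_of_mul_le_mul_right ?_ hp0
      linarith
    · refine le_of_mul_le_mul_right ?_ hp0
      linarith
  refine (encard_le_encard hsub).trans ?_
  rw [encard_coe_eq_coe_finsetCard]
  have hcard : F.card ≤ 3 * p ^ (initialPart I m).card := by
    refine (Finset.card_biUnion_le_card_mul _ _ 3 fun b _ => ?_).trans (by simp [mul_comm])
    refine Finset.card_image_le.trans ?_
    rw [Int.card_Icc, Int.toNat_le]
    have h2 : (⌊u b + 1⌋ : ℝ) - ⌈u b - 1⌉ ≤ 2 := by
      linarith [Int.floor_le (u b + 1), Int.le_ceil (u b - 1)]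
    have h3 : ⌊u b + 1⌋ - ⌈u b - 1⌉ ≤ 2 := by exact_mod_cast h2
    push_cast
    omega
  exact_mod_cast hcard

theorem spectrumPoint_lt_pow (hp : 2 ≤ p) (I : Set ℕ) (m : ℕ) (b : initialPart I m → Fin p) :
    spectrumPoint b < p ^ m := by
  have : NeZero p := ⟨by omega⟩
  obtain ⟨ω, rfl, -⟩ := exists_extend_digits b
  rw [spectrumPoint_restrict]
  have h1 : ∀ m : ℕ, ∑ i ∈ Finset.Icc 1 m, (ω i : ℕ) * p ^ (i - 1) < p ^ m := by
    intro m
    induction m with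
    | zero => simp
    | succ m ih =>
      rw [Finset.sum_Icc_succ_top (by omega), Nat.add_sub_cancel, pow_succ]
      have h2 := (ω (m + 1)).2
      calc _ < p ^ m + (ω (m + 1) : ℕ) * p ^ m := by gcongr
        _ = ((ω (m + 1) : ℕ) + 1) * p ^ m := by ring
        _ ≤ p * p ^ m := by gcongr; exact h2
        _ = _ := mul_comm _ _
  refine lt_of_le_of_lt (Finset.sum_le_sum_of_subset fun i hi => ?_) (h1 m)
  obtain ⟨h2, h3, -⟩ := mem_initialPart.1 hi
  exact Finset.mem_Icc.2 ⟨h2, h3⟩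

theorem le_encard_cantorSpectrum_inter_ball (hp : 2 ≤ p) (I : Set ℕ) (m : ℕ) :
    ((p ^ (initialPart I m).card : ℕ) : ℕ∞) ≤
      (cantorSpectrum p I ∩ Metric.ball 0 ((p : ℝ) ^ m)).encard := by
  have hsub : spectrumPart p I m ⊆ cantorSpectrum p I ∩ Metric.ball 0 ((p : ℝ) ^ m) := by
    refine subset_inter (subset_iUnion _ m) ?_
    rw [spectrumPart_eq]
    rintro _ ⟨b, rfl⟩
    rw [mem_ball_zero_iff, Real.norm_natCast]
    exact_mod_cast spectrumPoint_lt_pow hp I m b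
  refine le_trans (le_of_eq ?_) (encard_le_encard hsub)
  have hinj : Function.Injective
      fun b : initialPart I m → Fin p => ((spectrumPoint b : ℕ) : ℝ) := fun b b' h =>
    spectrumPoint_injective (fun i hi => (mem_initialPart.1 hi).1) (Nat.cast_injective h)
  rw [spectrumPart_eq, ← image_univ, hinj.encard_image, encard_univ]
  simp

theorem upperDensity_le_beurlingDim (hp : 2 ≤ p) (I : Set ℕ) :
    upperDensity I ≤ beurlingDim (cantorSpectrum p I) := by
  refine ENNReal.le_of_forall_nnreal_lt fun t ht => ?_
  rcases eq_or_ne t 0 with rfl | ht0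
  · simp
  have ht0' : (0 : ℝ) < t := by positivity
  have hp1 : (1 : ℝ) < p := by exact_mod_cast hp
  have hd : 0 < upperBeurlingDensity (cantorSpectrum p I) t := by
    refine zero_lt_one.trans_le (le_limsup_of_frequently_le' ?_)
    refine (tendsto_pow_atTop_atTop_of_one_lt hp1).frequently
      ((frequently_le_card ht).mono fun m hm => ?_)
    refine le_iSup_of_le 0 ?_
    have h0 : 0 < ((p : ℝ) ^ m) ^ (t : ℝ) := by positivity
    rw [ENNReal.le_div_iff_mul_le (Or.inl (ENNReal.ofReal_pos.2 h0).ne')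
      (Or.inl ENNReal.ofReal_ne_top), one_mul]
    have h1 : ENNReal.ofReal (((p : ℝ) ^ m) ^ (t : ℝ)) ≤
        ((p ^ (initialPart I m).card : ℕ) : ℝ≥0∞) := by
      rw [← ENNReal.ofReal_natCast]
      refine ENNReal.ofReal_le_ofReal ?_
      push_cast
      rw [← Real.rpow_natCast, ← Real.rpow_mul (by positivity), ← Real.rpow_natCast]
      exact Real.rpow_le_rpow_of_exponent_le hp1.le (by linarith)
    refine h1.trans ?_
    exact_mod_cast ENat.toENNReal_le.2 (le_encard_cantorSpectrum_inter_ball hp I m)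
  rw [← ENNReal.ofReal_coe_nnreal]
  exact le_iSup₂_of_le (t : ℝ) ht0' (le_iSup_of_le hd le_rfl)

theorem beurlingDim_le_upperDensity (hp : 2 ≤ p) (I : Set ℕ) :
    beurlingDim (cantorSpectrum p I) ≤ upperDensity I := by
  refine iSup₂_le fun r hr => iSup_le fun hd => ?_
  by_contra! hlt
  obtain ⟨t, ht1, ht2⟩ := ENNReal.lt_iff_exists_nnreal_btwn.1 hlt
  have htr : (t : ℝ) < r := by
    rw [← ENNReal.ofReal_coe_nnreal] at ht2
    exact (ENNReal.ofReal_lt_ofReal_iff hr).1 ht2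
  have hp1 : (1 : ℝ) < p := by exact_mod_cast hp
  obtain ⟨M, hM⟩ := eventually_atTop.1 (eventually_card_le ht1)
  set C : ℝ := 3 * (p : ℝ) ^ (t : ℝ) with hC
  have hbound : ∀ᶠ h : ℝ in atTop,
      (⨆ x : ℝ, ((cantorSpectrum p I ∩ Metric.ball x h).encard : ℝ≥0∞) / ENNReal.ofReal (h ^ r)) ≤
        ENNReal.ofReal (C * h ^ (-(r - t))) := by
    filter_upwards [eventually_ge_atTop ((p : ℝ) ^ M), eventually_ge_atTop 1] with h hhM hh1
    have hh0 : 0 < h := by linarith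
    obtain ⟨m, hm1, hm2⟩ := exists_nat_pow_near hh1 hp1
    have hmM : M ≤ m + 1 := ((pow_lt_pow_iff_right₀ hp1).1 (hhM.trans_lt hm2)).le
    refine iSup_le fun x => ?_
    have h0 : 0 < h ^ r := by positivity
    rw [ENNReal.div_le_iff (ENNReal.ofReal_pos.2 h0).ne' ENNReal.ofReal_ne_top,
      ← ENNReal.ofReal_mul (by positivity), mul_assoc, ← Real.rpow_add hh0,
      show -(r - t) + r = (t : ℝ) by ring]
    have h1 : ((cantorSpectrum p I ∩ Metric.ball x h).encard : ℝ≥0∞) ≤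
        ((3 * p ^ (initialPart I (m + 1)).card : ℕ) : ℝ≥0∞) := by
      exact_mod_cast ENat.toENNReal_le.2 (encard_cantorSpectrum_inter_ball_le hp I hm2.le)
    refine h1.trans ?_
    rw [← ENNReal.ofReal_natCast]
    refine ENNReal.ofReal_le_ofReal ?_
    push_cast
    rw [hC, mul_assoc, ← Real.mul_rpow (by positivity) hh0.le]
    gcongr
    calc (p : ℝ) ^ (initialPart I (m + 1)).card
        = (p : ℝ) ^ ((initialPart I (m + 1)).card : ℝ) := (Real.rpow_natCast _ _).symm
      _ ≤ (p : ℝ) ^ (t * (m + 1 : ℕ) : ℝ) :=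
        Real.rpow_le_rpow_of_exponent_le hp1.le (hM _ hmM)
      _ = ((p : ℝ) ^ (m + 1)) ^ (t : ℝ) := by
        rw [← Real.rpow_natCast, ← Real.rpow_mul (by positivity), mul_comm]
      _ ≤ ((p : ℝ) * h) ^ (t : ℝ) := by
        gcongr
        rw [pow_succ']
        gcongr
  have htend : Tendsto (fun h : ℝ => ENNReal.ofReal (C * h ^ (-(r - t)))) atTop (𝓝 0) := by
    have := ENNReal.tendsto_ofReal ((tendsto_rpow_neg_atTop (sub_pos.2 htr)).const_mul C)
    rwa [mul_zero, ENNReal.ofReal_zero] at this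
  have := limsup_le_limsup hbound
  rw [htend.limsup_eq] at this
  exact hd.not_ge this

theorem countable_cantorSpectrum (p : ℕ) (I : Set ℕ) : (cantorSpectrum p I).Countable :=
  countable_iUnion fun _ => (finite_range _).countable

/-! ### Exponentials and the Fourier transform of random digit sums -/

/-- The exponential `e_t(x) = exp(2πitx)`. -/
noncomputable def expo (t x : ℝ) : ℂ := Complex.exp (2 * Real.pi * Complex.I * t * x)

theorem expo_add_right (t x y : ℝ) : expo t (x + y) = expo t x * expo t y := by
  rw [expo, expo, expo, ← Complex.exp_add]
  push_cast
  ring_nf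

theorem expo_add_left (s t x : ℝ) : expo (s + t) x = expo s x * expo t x := by
  rw [expo, expo, expo, ← Complex.exp_add]
  push_cast
  ring_nf

theorem conj_expo (t x : ℝ) : (starRingEnd ℂ) (expo t x) = expo (-t) x := by
  rw [expo, expo, ← Complex.exp_conj]
  simp [map_ofNat (starRingEnd ℂ) 2]

theorem conj_expo_mul_expo (s t x : ℝ) :
    (starRingEnd ℂ) (expo s x) * expo t x = expo (t - s) x := by
  rw [conj_expo, ← expo_add_left, neg_add_eq_sub]

theorem norm_expo (t x : ℝ) : ‖expo t x‖ = 1 := by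
  rw [expo, show (2 * Real.pi * Complex.I * t * x : ℂ) = ((2 * Real.pi * t * x : ℝ) : ℂ) * Complex.I
    by push_cast; ring, Complex.norm_exp_ofReal_mul_I]

@[simp] theorem expo_zero_left (x : ℝ) : expo 0 x = 1 := by simp [expo]

theorem continuous_expo (t : ℝ) : Continuous (expo t) := by
  unfold expo
  fun_prop

theorem integral_comp_digit [NeZero p] (j : ℕ) (F : Fin p → ℂ) :
    ∫ ω, F (ω j) ∂digitMeasure p = (p : ℂ)⁻¹ * ∑ a, F a := by
  have h1 : (digitMeasure p).map (fun ω => ω j) = ProbabilityTheory.uniformOn univ :=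
    Measure.infinitePi_map_eval _ j
  rw [← integral_map (φ := fun ω : ℕ → Fin p => ω j) (f := F) (measurable_pi_apply j).aemeasurable
    StronglyMeasurable.of_discrete.aestronglyMeasurable, h1,
    integral_fintype (Integrable.of_finite), Finset.mul_sum]
  refine Finset.sum_congr rfl fun a _ => ?_
  rw [Measure.real, ProbabilityTheory.uniformOn_univ]
  simp

/-- The expectation is the mean of the powers `ζ^a`, `0 ≤ a < p`, of the root of unity
`ζ = exp(2πic/p) ≠ 1`, and these powers add up to `0`. -/
theorem integral_expo_digitSum_singleton (hp : 2 ≤ p) {j : ℕ} (hj : 1 ≤ j) {c : ℤ}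
    (hc : ¬ (p : ℤ) ∣ c) :
    ∫ ω, expo ((p : ℝ) ^ (j - 1) * c) (digitSum {j} ω) ∂digitMeasure p = 0 := by
  have : NeZero p := ⟨by omega⟩
  have hp0 : (p : ℂ) ≠ 0 := by
    have : p ≠ 0 := by omega
    exact_mod_cast this
  set ζ : ℂ := Complex.exp (2 * Real.pi * Complex.I * (c / p)) with hζ
  have h1 : ∀ ω : ℕ → Fin p,
      expo ((p : ℝ) ^ (j - 1) * c) (digitSum {j} ω) = ζ ^ (ω j : ℕ) := by
    intro ω
    rw [digitSum_singleton, expo, hζ, ← Complex.exp_nat_mul]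
    congr 1
    push_cast
    have h2 : (p : ℂ) ^ j = (p : ℂ) ^ (j - 1) * p := by
      rw [← pow_succ, Nat.sub_add_cancel hj]
    rw [h2]
    field_simp
  simp only [h1]
  rw [integral_comp_digit j fun a => ζ ^ (a : ℕ), Fin.sum_univ_eq_sum_range (fun a => ζ ^ a) p]
  have hζ1 : ζ ≠ 1 := by
    rw [hζ, Ne, Complex.exp_eq_one_iff]
    rintro ⟨n, hn⟩
    have h3 : (c / p : ℂ) = n := by
      have h4 : (2 * Real.pi * Complex.I : ℂ) ≠ 0 := Complex.two_pi_I_ne_zero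
      rw [mul_comm (n : ℂ)] at hn
      exact mul_left_cancel₀ h4 hn
    rw [div_eq_iff hp0] at h3
    exact hc ⟨n, by rw [mul_comm]; exact_mod_cast h3⟩
  have hζp : ζ ^ p = 1 := by
    rw [hζ, ← Complex.exp_nat_mul, Complex.exp_eq_one_iff]
    exact ⟨c, by field_simp⟩
  rw [geom_sum_eq hζ1, hζp, sub_self, zero_div, mul_zero]

theorem integral_expo_digitSum_union (hp : 2 ≤ p) {J J' : Set ℕ} (h : Disjoint J J') (t : ℝ) :
    ∫ ω, expo t (digitSum (J ∪ J') ω) ∂digitMeasure p =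
      (∫ ω, expo t (digitSum J ω) ∂digitMeasure p) *
        ∫ ω, expo t (digitSum J' ω) ∂digitMeasure p := by
  have hm := (continuous_expo t).measurable
  have hi := (indepFun_digitSum hp h).comp hm hm
  refine Eq.trans ?_ (ProbabilityTheory.IndepFun.integral_mul_eq_mul_integral hi
    (hm.comp (measurable_digitSum hp J)).aestronglyMeasurable
    (hm.comp (measurable_digitSum hp J')).aestronglyMeasurable)
  refine integral_congr_ae (ae_of_all _ fun ω => ?_)
  simp [digitSum_union hp h, expo_add_right]

theorem integral_expo_digitSum_eq_zero (hp : 2 ≤ p) {J : Set ℕ} {j : ℕ} (hjJ : j ∈ J)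
    (hj : 1 ≤ j) {c : ℤ} (hc : ¬ (p : ℤ) ∣ c) :
    ∫ ω, expo ((p : ℝ) ^ (j - 1) * c) (digitSum J ω) ∂digitMeasure p = 0 := by
  have h : J = {j} ∪ J \ {j} := by
    rw [union_sdiff_self, union_eq_right.2 (singleton_subset_iff.2 hjJ)]
  rw [h, integral_expo_digitSum_union hp disjoint_sdiff_right,
    integral_expo_digitSum_singleton hp hj hc, zero_mul]

theorem one_le_of_mem_initialPart {I : Set ℕ} {n : ℕ} : ∀ i ∈ initialPart I n, 1 ≤ i :=
  fun _ hi => (mem_initialPart.1 hi).1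

/-- Orthogonality of the exponentials with frequencies in `Λ_{I_n}`. -/
theorem integral_conj_expo_mul_expo (hp : 2 ≤ p) {I : Set ℕ} {n : ℕ} {J : Set ℕ}
    (hJ : (initialPart I n : Set ℕ) ⊆ J) (b b' : initialPart I n → Fin p) [Decidable (b = b')] :
    ∫ ω, (starRingEnd ℂ) (expo (spectrumPoint b) (digitSum J ω)) *
      expo (spectrumPoint b') (digitSum J ω) ∂digitMeasure p = if b = b' then 1 else 0 := by
  have : NeZero p := ⟨by omega⟩
  simp only [conj_expo_mul_expo]
  split_ifs with h
  · subst h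
    simp
  · obtain ⟨j, hj, c, hc, hsub⟩ := exists_spectrumPoint_sub one_le_of_mem_initialPart (Ne.symm h)
    have h1 : (spectrumPoint b' : ℝ) - spectrumPoint b = (p : ℝ) ^ (j - 1) * c := by
      exact_mod_cast congrArg (Int.cast : ℤ → ℝ) hsub
    rw [h1]
    exact integral_expo_digitSum_eq_zero hp (hJ hj) (one_le_of_mem_initialPart j hj) hc

/-- Parseval's identity for the uniform measure on `C(I_n)` and the frequencies `Λ_{I_n}`: there
are as many frequencies as points, so the orthonormal exponentials form a basis. -/
theorem sum_norm_sq_integral_initialPart (hp : 2 ≤ p) (I : Set ℕ) (n : ℕ) (g : ℝ → ℂ) :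
    ∑ b : initialPart I n → Fin p,
      ‖∫ ω, g (digitSum (initialPart I n : Set ℕ) ω) *
        (starRingEnd ℂ) (expo (spectrumPoint b) (digitSum (initialPart I n : Set ℕ) ω))
          ∂digitMeasure p‖ ^ 2 =
      ∫ ω, ‖g (digitSum (initialPart I n : Set ℕ) ω)‖ ^ 2 ∂digitMeasure p := by
  classical
  have : NeZero p := ⟨by omega⟩
  set S := initialPart I n with hS
  have hp0 : 0 < (p : ℝ) ^ S.card := by
    have : 0 < p := by omega
    positivity
  set r : ℝ := (Real.sqrt ((p : ℝ) ^ S.card))⁻¹ with hr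
  have hr0 : 0 < r := by positivity
  have hrr : r * r = ((p : ℝ) ^ S.card)⁻¹ := by
    rw [hr, ← mul_inv, Real.mul_self_sqrt hp0.le]
  have hrr' : (r : ℂ) * r = (((p : ℝ) ^ S.card)⁻¹ : ℝ) := by
    rw [← Complex.ofReal_mul, hrr]
  -- functions on `C(I_n)` as vectors, normalised so that the inner product is that of `L²`
  let v : (S → Fin p) → EuclideanSpace ℂ (S → Fin p) := fun b =>
    WithLp.toLp 2 fun a => (r : ℂ) * expo (spectrumPoint b) (cantorPoint a)
  let w : EuclideanSpace ℂ (S → Fin p) := WithLp.toLp 2 fun a => (r : ℂ) * g (cantorPoint a)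
  have hint : ∀ (b : S → Fin p) (F : (S → Fin p) → ℂ),
      inner ℂ (v b) (WithLp.toLp 2 fun a => (r : ℂ) * F a) =
      ∫ ω, F (S.restrict ω) * (starRingEnd ℂ) (expo (spectrumPoint b) (digitSum (S : Set ℕ) ω))
        ∂digitMeasure p := by
    intro b F
    simp only [digitSum_coe]
    rw [integral_restrict_digitMeasure S fun a =>
      F a * (starRingEnd ℂ) (expo (spectrumPoint b) (cantorPoint a)), PiLp.inner_apply,
      Complex.real_smul, ← hrr', Finset.mul_sum]
    refine Finset.sum_congr rfl fun a _ => ?_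
    simp only [v, RCLike.inner_apply, map_mul, Complex.conj_ofReal]
    ring
  have hon : Orthonormal ℂ v := by
    rw [orthonormal_iff_ite]
    intro b b'
    have h1 := hint b fun a => expo (spectrumPoint b') (cantorPoint a)
    change inner ℂ (v b) (v b') = _ at h1
    rw [h1, ← integral_conj_expo_mul_expo hp subset_rfl b b']
    refine integral_congr_ae (ae_of_all _ fun ω => ?_)
    simp only [digitSum_coe, mul_comm]
    rfl
  have hcard : Fintype.card (S → Fin p) = Module.finrank ℂ (EuclideanSpace ℂ (S → Fin p)) := by
    simp
  have hbasis : ⇑(basisOfLinearIndependentOfCardEqFinrank hon.linearIndependent hcard) = v :=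
    coe_basisOfLinearIndependentOfCardEqFinrank _ _
  let B := (basisOfLinearIndependentOfCardEqFinrank hon.linearIndependent hcard).toOrthonormalBasis
    (by rw [hbasis]; exact hon)
  have hB : ⇑B = v := by
    rw [Module.Basis.coe_toOrthonormalBasis, hbasis]
  have hpars := B.sum_sq_norm_inner_right w
  rw [hB] at hpars
  have hw : ‖w‖ ^ 2 = ∫ ω, ‖g (digitSum (S : Set ℕ) ω)‖ ^ 2 ∂digitMeasure p := by
    simp only [digitSum_coe]
    rw [integral_restrict_digitMeasure S fun a => ‖g (cantorPoint a)‖ ^ 2,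
      EuclideanSpace.norm_sq_eq, smul_eq_mul, ← hrr, Finset.mul_sum]
    refine Finset.sum_congr rfl fun a _ => ?_
    simp only [w, norm_mul, Complex.norm_real, Real.norm_of_nonneg hr0.le]
    ring
  rw [← hw, ← hpars]
  refine Finset.sum_congr rfl fun b _ => ?_
  rw [hint b fun a => g (cantorPoint a)]
  simp only [digitSum_coe]

/-- If the phases `t Z` stay in an interval of length `1/4`, there is no cancellation: centre the
phases at the midpoint and take real parts. -/
theorem cos_le_norm_integral_expo {Ω : Type*} [MeasurableSpace Ω] (P : Measure Ω)
    [IsProbabilityMeasure P] {Z : Ω → ℝ} (hZ : Measurable Z) {t : ℝ} (h0 : ∀ ω, 0 ≤ t * Z ω)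
    (h1 : ∀ ω, t * Z ω ≤ 1 / 4) :
    Real.cos (Real.pi / 4) ≤ ‖∫ ω, expo t (Z ω) ∂P‖ := by
  have hm : Measurable fun ω => expo 1 (-(1 / 8)) * expo t (Z ω) :=
    ((continuous_expo t).measurable.comp hZ).const_mul _
  have hi : Integrable (fun ω => expo 1 (-(1 / 8)) * expo t (Z ω)) P :=
    Integrable.of_bound hm.aestronglyMeasurable 1
      (ae_of_all _ fun ω => by rw [norm_mul, norm_expo, norm_expo, one_mul])
  have h2 : ‖∫ ω, expo t (Z ω) ∂P‖ = ‖∫ ω, expo 1 (-(1 / 8)) * expo t (Z ω) ∂P‖ := by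
    rw [integral_const_mul, norm_mul, norm_expo, one_mul]
  have hre : ∀ ω, RCLike.re (expo 1 (-(1 / 8)) * expo t (Z ω)) =
      Real.cos (2 * Real.pi * (t * Z ω - 1 / 8)) := by
    intro ω
    rw [expo, expo, ← Complex.exp_add, ← Complex.exp_ofReal_mul_I_re]
    simp only [RCLike.re_eq_complex_re]
    congr 2
    push_cast
    ring
  rw [h2]
  refine le_trans ?_ ((le_abs_self _).trans (RCLike.abs_re_le_norm _))
  rw [← integral_re hi]
  have hcos : ∀ ω, Real.cos (Real.pi / 4) ≤ RCLike.re (expo 1 (-(1 / 8)) * expo t (Z ω)) := by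
    intro ω
    have hpi := Real.pi_pos
    rw [hre, ← Real.cos_abs (2 * Real.pi * (t * Z ω - 1 / 8))]
    refine Real.cos_le_cos_of_nonneg_of_le_pi (abs_nonneg _) (by linarith) ?_
    rw [abs_mul, abs_of_pos (by positivity)]
    have h3 : |t * Z ω - 1 / 8| ≤ 1 / 8 := by
      rw [abs_le]
      constructor <;> linarith [h0 ω, h1 ω]
    nlinarith
  have := integral_mono (integrable_const (μ := P) (Real.cos (Real.pi / 4))) hi.re hcos
  simpa using this

/-- If `n + 1 ∉ I`, the digits beyond `n` do not destroy the Fourier coefficients at the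
frequencies in `Λ_{I_n}`. The digit at `n + 2` and the digits beyond `n + 2` are treated
separately; the phases of each of the two parts stay in an interval of length `1/4`. -/
theorem half_le_norm_integral_expo_tail (hp : 2 ≤ p) {I : Set ℕ} {n : ℕ} (hn : n + 1 ∉ I)
    (b : initialPart I n → Fin p) :
    1 / 2 ≤ ‖∫ ω, expo (spectrumPoint b) (digitSum (I ∩ Ioi n) ω) ∂digitMeasure p‖ := by
  have : NeZero p := ⟨by omega⟩
  have hp2 : (2 : ℝ) ≤ p := by exact_mod_cast hp
  have hsplit : I ∩ Ioi n = (I ∩ {n + 2}) ∪ (I ∩ Ioi (n + 2)) := by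
    rw [← inter_union_distrib_left]
    ext i
    simp only [mem_inter_iff, mem_Ioi, mem_union, mem_singleton_iff]
    refine and_congr_right fun hi => ?_
    have : i ≠ n + 1 := fun h => hn (h ▸ hi)
    omega
  have hdisj : Disjoint (I ∩ {n + 2}) (I ∩ Ioi (n + 2)) := by
    rw [Set.disjoint_left]
    rintro i ⟨-, rfl⟩ ⟨-, h⟩
    exact lt_irrefl _ (mem_Ioi.1 h)
  have hlam : (spectrumPoint b : ℝ) ≤ (p : ℝ) ^ n := by
    exact_mod_cast (spectrumPoint_lt_pow hp I n b).le
  have hpow : (p : ℝ) ^ n * ((p : ℝ) ^ (n + 2))⁻¹ = ((p : ℝ) ^ 2)⁻¹ := by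
    rw [pow_add]
    field_simp
  have hfirst : Real.cos (Real.pi / 4) ≤
      ‖∫ ω, expo (spectrumPoint b) (digitSum (I ∩ {n + 2}) ω) ∂digitMeasure p‖ := by
    refine cos_le_norm_integral_expo _ (measurable_digitSum hp _)
      (fun ω => mul_nonneg (Nat.cast_nonneg _) (digitSum_nonneg _ _)) fun ω => ?_
    have h1 : digitSum (I ∩ {n + 2}) ω ≤ (p - 1) * ((p : ℝ) ^ (n + 2))⁻¹ := by
      by_cases h : n + 2 ∈ I
      · rw [inter_eq_right.2 (singleton_subset_iff.2 h), digitSum_singleton]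
        gcongr
        have h3 := (ω (n + 2)).2
        have h4 : ((ω (n + 2) : ℕ) : ℝ) + 1 ≤ p := by exact_mod_cast h3
        linarith
      · rw [inter_singleton_eq_empty.2 h]
        simp only [digitSum, indicator_empty, tsum_zero]
        have : (0 : ℝ) ≤ p - 1 := by linarith
        positivity
    calc (spectrumPoint b : ℝ) * digitSum (I ∩ {n + 2}) ω
        ≤ (p : ℝ) ^ n * ((p - 1) * ((p : ℝ) ^ (n + 2))⁻¹) := by
          gcongr
          exact digitSum_nonneg _ _
      _ = (p - 1) * ((p : ℝ) ^ 2)⁻¹ := by rw [← hpow]; ring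
      _ ≤ 1 / 4 := by
        rw [mul_inv_le_iff₀ (by positivity)]
        nlinarith [sq_nonneg ((p : ℝ) - 2)]
  have hsecond : Real.cos (Real.pi / 4) ≤
      ‖∫ ω, expo (spectrumPoint b) (digitSum (I ∩ Ioi (n + 2)) ω) ∂digitMeasure p‖ := by
    refine cos_le_norm_integral_expo _ (measurable_digitSum hp _)
      (fun ω => mul_nonneg (Nat.cast_nonneg _) (digitSum_nonneg _ _)) fun ω => ?_
    calc (spectrumPoint b : ℝ) * digitSum (I ∩ Ioi (n + 2)) ω
        ≤ (p : ℝ) ^ n * ((p : ℝ) ^ (n + 2))⁻¹ := by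
          gcongr
          · exact digitSum_nonneg _ _
          · exact digitSum_tail_le hp I (n + 2) ω
      _ = ((p : ℝ) ^ 2)⁻¹ := hpow
      _ ≤ 1 / 4 := by
        rw [inv_le_comm₀ (by positivity) (by norm_num)]
        nlinarith
  rw [hsplit, integral_expo_digitSum_union hp hdisj, norm_mul]
  have hcos : Real.cos (Real.pi / 4) * Real.cos (Real.pi / 4) = 1 / 2 := by
    rw [Real.cos_pi_div_four]
    nlinarith [Real.mul_self_sqrt (show (0 : ℝ) ≤ 2 by norm_num)]
  have hcos0 : 0 ≤ Real.cos (Real.pi / 4) := by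
    rw [Real.cos_pi_div_four]
    positivity
  rw [← hcos]
  exact mul_le_mul hfirst hsecond hcos0 (norm_nonneg _)

/-! ### Completeness of the exponentials -/

theorem inner_toLp_toLp {α : Type*} [MeasurableSpace α] {μ : Measure α} {f g : α → ℂ}
    (hf : MemLp f 2 μ) (hg : MemLp g 2 μ) :
    inner ℂ (hf.toLp f) (hg.toLp g) = ∫ x, (starRingEnd ℂ) (f x) * g x ∂μ := by
  rw [L2.inner_def]
  refine integral_congr_ae ?_
  filter_upwards [hf.coeFn_toLp, hg.coeFn_toLp] with x hx hx'
  rw [hx, hx', RCLike.inner_apply, mul_comm]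

theorem norm_sq_toLp {α : Type*} [MeasurableSpace α] {μ : Measure α} {f : α → ℂ}
    (hf : MemLp f 2 μ) : ‖hf.toLp f‖ ^ 2 = ∫ x, ‖f x‖ ^ 2 ∂μ := by
  have h := inner_self_eq_norm_sq_to_K (𝕜 := ℂ) (hf.toLp f)
  rw [inner_toLp_toLp hf hf] at h
  have h1 : ∀ x, (starRingEnd ℂ) (f x) * f x = ((‖f x‖ ^ 2 : ℝ) : ℂ) := fun x => by
    rw [Complex.conj_mul']
    push_cast
    rfl
  simp only [h1] at h
  rw [integral_complex_ofReal] at h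
  refine (Complex.ofReal_injective (h.trans ?_)).symm
  push_cast
  rfl

/-- Bessel's inequality in terms of integrals. -/
theorem sum_norm_sq_integral_le {α ι : Type*} [MeasurableSpace α] [Fintype ι] [DecidableEq ι]
    {μ : Measure α} {φ : ι → α → ℂ} (hφ : ∀ i, MemLp (φ i) 2 μ)
    (horth : ∀ i j, ∫ x, (starRingEnd ℂ) (φ i x) * φ j x ∂μ = if i = j then 1 else 0)
    {h : α → ℂ} (hh : MemLp h 2 μ) :
    ∑ i, ‖∫ x, h x * (starRingEnd ℂ) (φ i x) ∂μ‖ ^ 2 ≤ ∫ x, ‖h x‖ ^ 2 ∂μ := by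
  have hon : Orthonormal ℂ fun i => (hφ i).toLp (φ i) := by
    rw [orthonormal_iff_ite]
    intro i j
    rw [inner_toLp_toLp, horth]
  have := hon.sum_inner_products_le (hh.toLp h) (s := Finset.univ)
  rw [norm_sq_toLp] at this
  refine le_trans (le_of_eq ?_) this
  refine Finset.sum_congr rfl fun i _ => ?_
  rw [inner_toLp_toLp]
  simp only [mul_comm]

theorem memLp_expo {α : Type*} [MeasurableSpace α] (μ : Measure α) [IsFiniteMeasure μ] (t : ℝ)
    {X : α → ℝ} (hX : Measurable X) : MemLp (fun ω => expo t (X ω)) 2 μ :=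
  MemLp.of_bound ((continuous_expo t).measurable.comp hX).aestronglyMeasurable 1
    (ae_of_all _ fun _ => (norm_expo _ _).le)

theorem initialPart_subset_inter_Ioi (I : Set ℕ) (n : ℕ) :
    (initialPart I n : Set ℕ) ⊆ I ∩ Ioi 0 := by
  rw [coe_initialPart]
  exact inter_subset_inter_right I Ioc_subset_Ioi_self

theorem integral_cantorMeasure (hp : 2 ≤ p) (I : Set ℕ) {E : Type*} [NormedAddCommGroup E]
    [NormedSpace ℝ E] {F : ℝ → E} (hF : AEStronglyMeasurable F (cantorMeasure p I)) :
    ∫ x, F x ∂cantorMeasure p I = ∫ ω, F (digitSum (I ∩ Ioi 0) ω) ∂digitMeasure p :=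
  integral_map (measurable_digitSum hp _).aemeasurable hF

open scoped BoundedContinuousFunction

/-- A function orthogonal to all exponentials with frequencies in the spectrum is far from every
continuous function, relative to the norm of the latter. If `n + 1 ∉ I`, compare the continuous
function `g` at `X` and at the partial sum `Y` of order `n`: the coefficients of `g(Y)` factor into
those for `C(I_n)`, which satisfy Parseval's identity, and the Fourier transform of the tail, which
is bounded below; on the other hand they are the coefficients of `g(Y) - f(X)` with respect to an
orthonormal family. -/
theorem integral_norm_sq_le_of_orthogonal (hp : 2 ≤ p) {I : Set ℕ} (hI : Iᶜ.Infinite) {f : ℝ → ℂ}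
    (hf : MemLp f 2 (cantorMeasure p I))
    (horth : ∀ t ∈ cantorSpectrum p I, expCoeff (cantorMeasure p I) f t = 0) (g : ℝ →ᵇ ℂ) :
    1 / 4 * ∫ x, ‖g x‖ ^ 2 ∂cantorMeasure p I ≤ ∫ x, ‖g x - f x‖ ^ 2 ∂cantorMeasure p I := by
  classical
  have : NeZero p := ⟨by omega⟩
  set P := digitMeasure p with hP
  set X : (ℕ → Fin p) → ℝ := digitSum (I ∩ Ioi 0) with hX
  let Y : ℕ → (ℕ → Fin p) → ℝ := fun n => digitSum (initialPart I n : Set ℕ)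
  have hXm : Measurable X := measurable_digitSum hp _
  have hYm : ∀ n, Measurable (Y n) := fun n => measurable_digitSum hp _
  have hfX : MemLp (fun ω => f (X ω)) 2 P := hf.comp_of_map hXm.aemeasurable
  have hgY : ∀ n, MemLp (fun ω => g (Y n ω)) 2 P := fun n =>
    MemLp.of_bound (g.continuous.measurable.comp (hYm n)).aestronglyMeasurable ‖g‖
      (ae_of_all _ fun ω => g.norm_coe_le_norm _)
  have hstep : ∀ n, n + 1 ∉ I →
      1 / 4 * ∫ ω, ‖g (Y n ω)‖ ^ 2 ∂P ≤ ∫ ω, ‖g (Y n ω) - f (X ω)‖ ^ 2 ∂P := by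
    intro n hn
    have hbes := sum_norm_sq_integral_le (μ := P)
      (φ := fun (b : initialPart I n → Fin p) ω => expo (spectrumPoint b) (X ω))
      (fun b => memLp_expo P _ hXm)
      (fun b b' => integral_conj_expo_mul_expo hp (initialPart_subset_inter_Ioi I n) b b')
      ((hgY n).sub hfX)
    refine le_trans ?_ hbes
    rw [← sum_norm_sq_integral_initialPart hp I n g, Finset.mul_sum]
    refine Finset.sum_le_sum fun b _ => ?_
    have he : MemLp (fun ω => (starRingEnd ℂ) (expo (spectrumPoint b) (X ω))) 2 P := by
      simp only [conj_expo]
      exact memLp_expo P _ hXm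
    have hzero : ∫ ω, f (X ω) * (starRingEnd ℂ) (expo (spectrumPoint b) (X ω)) ∂P = 0 := by
      have hmem : (spectrumPoint b : ℝ) ∈ cantorSpectrum p I := by
        refine mem_iUnion.2 ⟨n, ?_⟩
        rw [spectrumPart_eq]
        exact ⟨b, rfl⟩
      have h1 := horth _ hmem
      rw [← integral_cantorMeasure hp I (F := fun x => f x *
        (starRingEnd ℂ) (expo (spectrumPoint b) x))]
      · exact h1
      · refine hf.aestronglyMeasurable.mul ?_
        simp only [conj_expo]
        exact (continuous_expo _).aestronglyMeasurable
    have hsub : ∫ ω, (g (Y n ω) - f (X ω)) *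
        (starRingEnd ℂ) (expo (spectrumPoint b) (X ω)) ∂P =
        ∫ ω, g (Y n ω) * (starRingEnd ℂ) (expo (spectrumPoint b) (X ω)) ∂P := by
      simp only [sub_mul]
      refine (integral_sub ((hgY n).integrable_mul he) (hfX.integrable_mul he)).trans ?_
      refine (congrArg₂ (· - ·) rfl hzero).trans (sub_zero _)
    have hfactor : ∫ ω, g (Y n ω) * (starRingEnd ℂ) (expo (spectrumPoint b) (X ω)) ∂P =
        (∫ ω, g (Y n ω) * (starRingEnd ℂ) (expo (spectrumPoint b) (Y n ω)) ∂P) *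
          ∫ ω, (starRingEnd ℂ) (expo (spectrumPoint b) (digitSum (I ∩ Ioi n) ω)) ∂P := by
      have hm1 : Measurable fun y => g y * (starRingEnd ℂ) (expo (spectrumPoint b) y) := by
        simp only [conj_expo]
        exact g.continuous.measurable.mul (continuous_expo _).measurable
      have hm2 : Measurable fun y => (starRingEnd ℂ) (expo (spectrumPoint b) y) := by
        simp only [conj_expo]
        exact (continuous_expo _).measurable
      have hi := (indepFun_digitSum hp (disjoint_initialPart_tail I n)).comp hm1 hm2
      refine Eq.trans ?_ (ProbabilityTheory.IndepFun.integral_mul_eq_mul_integral hi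
        (hm1.comp (hYm n)).aestronglyMeasurable
        (hm2.comp (measurable_digitSum hp _)).aestronglyMeasurable)
      refine integral_congr_ae (ae_of_all _ fun ω => ?_)
      simp only [X, Y, digitSum_eq_add hp I n ω, expo_add_right, map_mul, Pi.mul_apply,
        mul_assoc]
    have htail : 1 / 2 ≤
        ‖∫ ω, (starRingEnd ℂ) (expo (spectrumPoint b) (digitSum (I ∩ Ioi n) ω)) ∂P‖ := by
      rw [integral_conj, RCLike.norm_conj]
      exact half_le_norm_integral_expo_tail hp hn b
    change _ ≤ ‖∫ ω, (g (Y n ω) - f (X ω)) *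
        (starRingEnd ℂ) (expo (spectrumPoint b) (X ω)) ∂P‖ ^ 2
    rw [hsub, hfactor, norm_mul, mul_pow, mul_comm]
    gcongr
    nlinarith
  have hfreq : ∃ᶠ n in atTop, n + 1 ∉ I := by
    rw [Nat.frequently_atTop_iff_infinite]
    refine Set.infinite_of_forall_exists_gt fun a => ?_
    obtain ⟨m, hm, ham⟩ := hI.exists_gt (a + 1)
    refine ⟨m - 1, ?_, by omega⟩
    rwa [mem_ofPred_eq, Nat.sub_add_cancel (by omega)]
  have hlim : ∀ ω, Tendsto (fun n => g (Y n ω)) atTop (𝓝 (g (X ω))) := fun ω =>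
    (g.continuous.tendsto _).comp (tendsto_digitSum_initialPart hp I ω)
  have hl1 : Tendsto (fun n => ∫ ω, ‖g (Y n ω)‖ ^ 2 ∂P) atTop (𝓝 (∫ ω, ‖g (X ω)‖ ^ 2 ∂P)) := by
    refine tendsto_integral_of_dominated_convergence (fun _ => ‖g‖ ^ 2)
      (fun n => (hgY n).aestronglyMeasurable.norm.pow 2) (integrable_const _)
      (fun n => ae_of_all _ fun ω => ?_) (ae_of_all _ fun ω => (hlim ω).norm.pow 2)
    rw [Real.norm_of_nonneg (by positivity)]
    gcongr
    exact g.norm_coe_le_norm _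
  have hl2 : Tendsto (fun n => ∫ ω, ‖g (Y n ω) - f (X ω)‖ ^ 2 ∂P) atTop
      (𝓝 (∫ ω, ‖g (X ω) - f (X ω)‖ ^ 2 ∂P)) := by
    refine tendsto_integral_of_dominated_convergence (fun ω => 2 * ‖g‖ ^ 2 + 2 * ‖f (X ω)‖ ^ 2)
      (fun n => ((hgY n).sub hfX).aestronglyMeasurable.norm.pow 2)
      ((integrable_const _).add ((hfX.integrable_norm_pow two_ne_zero).const_mul 2))
      (fun n => ae_of_all _ fun ω => ?_)
      (ae_of_all _ fun ω => ((hlim ω).sub tendsto_const_nhds).norm.pow 2)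
    rw [Real.norm_of_nonneg (by positivity)]
    have h1 := norm_sub_le (g (Y n ω)) (f (X ω))
    have h2 := g.norm_coe_le_norm (Y n ω)
    have h3 : ‖g (Y n ω) - f (X ω)‖ ≤ ‖g‖ + ‖f (X ω)‖ := by linarith
    calc ‖g (Y n ω) - f (X ω)‖ ^ 2 ≤ (‖g‖ + ‖f (X ω)‖) ^ 2 := by gcongr
      _ ≤ _ := by nlinarith [sq_nonneg (‖g‖ - ‖f (X ω)‖)]
  have hfinal := le_of_tendsto_of_tendsto_of_frequently (hl1.const_mul (1 / 4)) hl2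
    (hfreq.mono hstep)
  rw [integral_cantorMeasure hp I (F := fun x => ‖g x‖ ^ 2)
      (g.continuous.norm.pow 2).aestronglyMeasurable,
    integral_cantorMeasure hp I (F := fun x => ‖g x - f x‖ ^ 2)
      ((g.continuous.aestronglyMeasurable.sub hf.aestronglyMeasurable).norm.pow 2)]
  exact hfinal

theorem toLp_eq_zero_of_orthogonal (hp : 2 ≤ p) {I : Set ℕ} (hI : Iᶜ.Infinite) {f : ℝ → ℂ}
    (hf : MemLp f 2 (cantorMeasure p I))
    (horth : ∀ t ∈ cantorSpectrum p I, expCoeff (cantorMeasure p I) f t = 0) :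
    hf.toLp f = 0 := by
  have := isProbabilityMeasure_cantorMeasure hp I
  rw [← norm_eq_zero]
  refine le_antisymm (le_of_forall_pos_le_add fun ε hε => ?_) (norm_nonneg _)
  obtain ⟨g, hg, hgm⟩ := hf.exists_boundedContinuous_eLpNorm_sub_le (by simp)
    (ε := ENNReal.ofReal (ε / 3)) (by simpa using hε)
  have h1 := integral_norm_sq_le_of_orthogonal hp hI hf horth g
  have h2 : ‖hgm.toLp g‖ ^ 2 = ∫ x, ‖g x‖ ^ 2 ∂cantorMeasure p I := norm_sq_toLp hgm
  have h3 : ‖(hgm.sub hf).toLp (⇑g - f)‖ ^ 2 = ∫ x, ‖g x - f x‖ ^ 2 ∂cantorMeasure p I :=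
    norm_sq_toLp (hgm.sub hf)
  rw [← h2, ← h3, MemLp.toLp_sub hgm hf] at h1
  have h4 : ‖hgm.toLp g - hf.toLp f‖ ≤ ε / 3 := by
    rw [norm_sub_rev, ← MemLp.toLp_sub hf hgm, Lp.norm_toLp]
    exact ENNReal.toReal_le_of_le_ofReal (by positivity) hg
  have h5 : ‖hgm.toLp g‖ ≤ 2 * ‖hgm.toLp g - hf.toLp f‖ := by
    refine le_of_sq_le_sq ?_ (by positivity)
    nlinarith
  have h6 := norm_sub_le (hgm.toLp g) (hgm.toLp g - hf.toLp f)
  rw [sub_sub_cancel] at h6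
  linarith

theorem expCoeff_eq_inner {μ : Measure ℝ} [IsFiniteMeasure μ] {f : ℝ → ℂ} (hf : MemLp f 2 μ)
    (t : ℝ) : expCoeff μ f t =
      inner ℂ ((memLp_expo μ t measurable_id).toLp (fun x => expo t (id x))) (hf.toLp f) := by
  rw [inner_toLp_toLp, expCoeff]
  refine integral_congr_ae (ae_of_all _ fun x => ?_)
  exact mul_comm _ _

/-- The exponentials with frequencies in the spectrum form an orthonormal basis. -/
theorem isSpectrum_cantorMeasure (hp : 2 ≤ p) {I : Set ℕ} (hI : Iᶜ.Infinite)
    [IsProbabilityMeasure (cantorMeasure p I)] :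
    IsSpectrum (cantorMeasure p I) (cantorSpectrum p I) := by
  classical
  have : NeZero p := ⟨by omega⟩
  set μ := cantorMeasure p I with hμ
  let E : cantorSpectrum p I → Lp ℂ 2 μ := fun t =>
    (memLp_expo μ t measurable_id).toLp (fun x => expo t (id x))
  have hon : Orthonormal ℂ E := by
    rw [orthonormal_iff_ite]
    rintro ⟨s, hs⟩ ⟨t, ht⟩
    simp only [E]
    rw [inner_toLp_toLp]
    obtain ⟨m, hm⟩ := mem_iUnion.1 hs
    obtain ⟨n, hn⟩ := mem_iUnion.1 ht
    have hs' := spectrumPart_mono I (le_max_left m n) hm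
    have ht' := spectrumPart_mono I (le_max_right m n) hn
    rw [spectrumPart_eq] at hs' ht'
    obtain ⟨b, rfl⟩ := hs'
    obtain ⟨b', rfl⟩ := ht'
    have h1 := integral_conj_expo_mul_expo hp (J := I ∩ Ioi 0)
      (initialPart_subset_inter_Ioi I _) b b'
    have h2 : AEStronglyMeasurable (fun x => (starRingEnd ℂ) (expo (spectrumPoint b) (id x)) *
        expo (spectrumPoint b') (id x)) μ := by
      simp only [conj_expo_mul_expo]
      exact (continuous_expo _).aestronglyMeasurable
    rw [integral_cantorMeasure hp I h2]
    refine h1.trans (if_congr ?_ rfl rfl)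
    rw [Subtype.mk.injEq, Nat.cast_inj]
    exact (spectrumPoint_injective one_le_of_mem_initialPart).eq_iff.symm
  have hsp : (Submodule.span ℂ (range E))ᗮ = ⊥ := by
    rw [Submodule.eq_bot_iff]
    intro x hx
    have hxm : MemLp (x : ℝ → ℂ) 2 μ := Lp.memLp x
    have h0 := toLp_eq_zero_of_orthogonal hp hI hxm fun t ht => by
      rw [expCoeff_eq_inner hxm t, Lp.toLp_coeFn]
      exact (Submodule.mem_orthogonal _ _).1 hx _ (Submodule.subset_span ⟨⟨t, ht⟩, rfl⟩)
    rwa [Lp.toLp_coeFn] at h0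
  let B := HilbertBasis.mkOfOrthogonalEqBot hon hsp
  have hpars : ∀ f : ℝ → ℂ, MemLp f 2 μ →
      ∑' t : cantorSpectrum p I, ‖expCoeff μ f t‖ₑ ^ 2 = eLpNorm f 2 μ ^ 2 := by
    intro f hf
    have h1 := lp.hasSum_norm (by norm_num) (B.repr (hf.toLp f))
    have h2 : ∀ t, B.repr (hf.toLp f) t = expCoeff μ f t := by
      intro t
      rw [B.repr_apply_apply, expCoeff_eq_inner hf]
      simp only [B, HilbertBasis.coe_mkOfOrthogonalEqBot]
      rfl
    simp only [h2, LinearIsometryEquiv.norm_map, ENNReal.toReal_ofNat, Real.rpow_ofNat] at h1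
    have h3 : eLpNorm f 2 μ ^ 2 = ENNReal.ofReal (‖hf.toLp f‖ ^ 2) := by
      rw [Lp.norm_toLp, ENNReal.ofReal_pow ENNReal.toReal_nonneg, ENNReal.ofReal_toReal
        hf.eLpNorm_ne_top]
    rw [h3, ← h1.tsum_eq, ENNReal.ofReal_tsum_of_nonneg (fun t => by positivity) h1.summable]
    refine tsum_congr fun t => ?_
    rw [ENNReal.ofReal_pow (norm_nonneg _), ofReal_norm]
  intro f hf
  rw [hpars f hf, ENNReal.coe_one, one_mul]
  exact ⟨le_rfl, le_rfl⟩

/-! ### Sets of digit positions -/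

theorem upperDensity_le_one (I : Set ℕ) : upperDensity I ≤ 1 := by
  refine limsup_le_of_le (by isBoundedDefault) (Eventually.of_forall fun n => ?_)
  refine ENNReal.div_le_of_le_mul ?_
  rw [one_mul]
  exact_mod_cast card_initialPart_le I n

theorem one_le_lowerDensity_of_finite_compl {I : Set ℕ} (h : Iᶜ.Finite) : 1 ≤ lowerDensity I := by
  classical
  refine ENNReal.le_of_forall_nnreal_lt fun t ht => ?_
  have ht1 : (t : ℝ) < 1 := by exact_mod_cast ht
  have hcard : ∀ m : ℕ, (m : ℝ) ≤ (initialPart I m).card + h.toFinset.card := by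
    intro m
    have hsub : Finset.Icc 1 m ⊆ initialPart I m ∪ h.toFinset := by
      intro i hi
      rw [Finset.mem_Icc] at hi
      rw [Finset.mem_union, mem_initialPart, Set.Finite.mem_toFinset, mem_compl_iff]
      by_cases hiI : i ∈ I
      · exact Or.inl ⟨hi.1, hi.2, hiI⟩
      · exact Or.inr hiI
    have := (Finset.card_le_card hsub).trans (Finset.card_union_le _ _)
    rw [Nat.card_Icc, Nat.add_sub_cancel] at this
    exact_mod_cast this
  have hev : ∀ᶠ n : ℕ in atTop, (h.toFinset.card : ℝ) ≤ (1 - t) * n :=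
    (tendsto_natCast_atTop_atTop.const_mul_atTop (sub_pos.2 ht1)).eventually_ge_atTop _
  refine le_liminf_of_le (by isBoundedDefault) ?_
  filter_upwards [hev, eventually_gt_atTop 0] with n h1 h2
  have h0 : (n : ℝ≥0∞) ≠ 0 := by exact_mod_cast h2.ne'
  rw [ENNReal.le_div_iff_mul_le (Or.inl h0) (Or.inl (ENNReal.natCast_ne_top n))]
  have h3 : (t : ℝ) * n ≤ (initialPart I n).card := by linarith [hcard n]
  exact_mod_cast h3

theorem infinite_compl_of_lowerDensity_lt {I : Set ℕ} (h : lowerDensity I < upperDensity I) :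
    Iᶜ.Infinite := fun hfin =>
  absurd ((upperDensity_le_one I).trans (one_le_lowerDensity_of_finite_compl hfin)) (not_le.2 h)

/-- The integers whose number of digits in base `4` is odd have different lower and upper
densities. -/
theorem lowerDensity_lt_upperDensity_even_log :
    lowerDensity {i : ℕ | Even (Nat.log 4 i)} < upperDensity {i : ℕ | Even (Nat.log 4 i)} := by
  classical
  set I : Set ℕ := {i : ℕ | Even (Nat.log 4 i)} with hI
  have htend : ∀ c : ℕ, Tendsto (fun k : ℕ => 4 ^ (2 * k + c)) atTop atTop := fun c =>
    tendsto_atTop_mono (fun k => (show k ≤ 2 * k + c by omega).trans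
      (Nat.lt_pow_self (by norm_num)).le) tendsto_id
  have hlower : lowerDensity I ≤ 1 / 4 := by
    -- up to `4^{2k+2}`, the elements of `I` lie below `4^{2k+1}`, apart from `4^{2k+2}` itself
    refine liminf_le_of_frequently_le' ((htend 2).frequently (Frequently.of_forall fun k => ?_))
    have hsub : initialPart I (4 ^ (2 * k + 2)) ⊆
        insert (4 ^ (2 * k + 2)) (Finset.Icc 1 (4 ^ (2 * k + 1) - 1)) := by
      intro i hi
      obtain ⟨h1, h2, h3⟩ := mem_initialPart.1 hi
      rw [Finset.mem_insert, Finset.mem_Icc]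
      rcases h2.eq_or_lt with h2 | h2
      · exact Or.inl h2
      · refine Or.inr ⟨h1, ?_⟩
        have h4 : Nat.log 4 i < 2 * k + 2 := (Nat.log_lt_iff_lt_pow (by norm_num) (by omega)).2 h2
        have h5 : Nat.log 4 i < 2 * k + 1 := by
          obtain ⟨r, hr⟩ := h3
          omega
        have h6 := (Nat.log_lt_iff_lt_pow (by norm_num) (by omega)).1 h5
        omega
    have hcard : (initialPart I (4 ^ (2 * k + 2))).card ≤ 4 ^ (2 * k + 1) := by
      have h1 := (Finset.card_le_card hsub).trans (Finset.card_insert_le _ _)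
      rw [Nat.card_Icc] at h1
      have h2 : 0 < 4 ^ (2 * k + 1) := by positivity
      omega
    refine ENNReal.div_le_of_le_mul ?_
    have h3 : ((4 ^ (2 * k + 2) : ℕ) : ℝ≥0∞) = 4 * ((4 ^ (2 * k + 1) : ℕ) : ℝ≥0∞) := by
      push_cast
      ring
    rw [h3, ← mul_assoc, ENNReal.div_mul_cancel (by norm_num) (by norm_num), one_mul]
    exact_mod_cast hcard
  have hupper : 3 / 4 ≤ upperDensity I := by
    -- the whole block from `4^{2k}` to `4^{2k+1} - 1` belongs to `I`
    refine le_limsup_of_frequently_le' ((htend 1).frequently (Frequently.of_forall fun k => ?_))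
    have hsub : Finset.Ico (4 ^ (2 * k)) (4 ^ (2 * k + 1)) ⊆
        initialPart I (4 ^ (2 * k + 1)) := by
      intro i hi
      rw [Finset.mem_Ico] at hi
      have h1 : 0 < 4 ^ (2 * k) := by positivity
      refine mem_initialPart.2 ⟨by omega, hi.2.le, ?_⟩
      have h2 : Nat.log 4 i = 2 * k := Nat.log_eq_of_pow_le_of_lt_pow hi.1 hi.2
      exact ⟨k, by rw [h2, two_mul]⟩
    have hcard : 3 * 4 ^ (2 * k) ≤ (initialPart I (4 ^ (2 * k + 1))).card := by
      have h1 := Finset.card_le_card hsub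
      have h2 : 4 ^ (2 * k + 1) = 4 ^ (2 * k) * 4 := pow_succ _ _
      rw [Nat.card_Ico] at h1
      omega
    rw [ENNReal.le_div_iff_mul_le (Or.inl (by positivity)) (Or.inl (ENNReal.natCast_ne_top _))]
    have h3 : ((4 ^ (2 * k + 1) : ℕ) : ℝ≥0∞) = 4 * ((4 ^ (2 * k) : ℕ) : ℝ≥0∞) := by
      push_cast
      ring
    rw [h3, ← mul_assoc, ENNReal.div_mul_cancel (by norm_num) (by norm_num)]
    exact_mod_cast hcard
  refine hlower.trans_lt (lt_of_lt_of_le ?_ hupper)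
  exact ENNReal.div_lt_div_right (by norm_num) (by norm_num) (by norm_num)

/-! ### The dimensions of the measure and of its restrictions -/

theorem upperEntropyDim_condOn_univ (ν : ProbabilityMeasure ℝ) :
    upperEntropyDim (condOn ν (RestrictionSet.whole ν).1) = upperEntropyDim (ν : Measure ℝ) := by
  have h : condOn ν (RestrictionSet.whole ν).1 = (ν : Measure ℝ) := condOn_univ ν
  simp only [upperEntropyDim, dyadicEntropy, h]

theorem upperHausdorffDim_condOn_univ (ν : ProbabilityMeasure ℝ) :
    upperHausdorffDim (condOn ν (RestrictionSet.whole ν).1) =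
      upperHausdorffDim (ν : Measure ℝ) := by
  have h : condOn ν (RestrictionSet.whole ν).1 = (ν : Measure ℝ) := condOn_univ ν
  simp only [upperHausdorffDim, h]

/-- The dimensions of the Cantor-type measure `ν_I`. -/
theorem dimensions_cantorProb (p : ℕ) (hp : 2 ≤ p) (I : Set ℕ) :
    beurlingDim (cantorSpectrum p I) = upperDensity I ∧
    upperEntropyDim (cantorProb p hp I : Measure ℝ) = upperDensity I ∧
    dimH (cantorProb p hp I : Measure ℝ).support = lowerDensity I ∧
    upperHausdorffDim (cantorProb p hp I : Measure ℝ) = lowerDensity I ∧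
    lowerHausdorffDim (cantorProb p hp I : Measure ℝ) = lowerDensity I := by
  have hprob := isProbabilityMeasure_cantorMeasure hp I
  have h1 : lowerDensity I ≤ lowerHausdorffDim (cantorProb p hp I : Measure ℝ) :=
    le_iInf₂ fun A _ => le_iInf fun hA => lowerDensity_le_dimH hp hA
  have h2 := lowerHausdorffDim_le_upperHausdorffDim (cantorProb p hp I : Measure ℝ)
  have h3 := upperHausdorffDim_le_dimH_support (cantorProb p hp I : Measure ℝ)
  have h4 : dimH (cantorProb p hp I : Measure ℝ).support ≤ lowerDensity I := dimH_support_le hp I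
  refine ⟨(beurlingDim_le_upperDensity hp I).antisymm (upperDensity_le_beurlingDim hp I),
    (upperEntropyDim_cantorMeasure_le hp I).antisymm ?_, ?_, ?_, ?_⟩
  · exact (upperEntropyDim_condOn_univ (cantorProb p hp I)) ▸
      upperDensity_le_upperEntropyDim_condOn hp I (RestrictionSet.whole _)
  · exact h4.antisymm (h1.trans (h2.trans h3))
  · exact (h3.trans h4).antisymm (h1.trans h2)
  · exact (h2.trans (h3.trans h4)).antisymm h1

/-- The dimensions of the restrictions of `ν_I` are minimised by the whole measure. -/
theorem iInf_dimensions_condOn_cantorProb (p : ℕ) (hp : 2 ≤ p) (I : Set ℕ) :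
    (⨅ K : RestrictionSet (cantorProb p hp I),
      upperEntropyDim (condOn (cantorProb p hp I) K.1)) = upperDensity I ∧
    (⨅ K : RestrictionSet (cantorProb p hp I),
      upperHausdorffDim (condOn (cantorProb p hp I) K.1)) = lowerDensity I ∧
    (⨅ K : RestrictionSet (cantorProb p hp I),
      lowerHausdorffDim (condOn (cantorProb p hp I) K.1)) = lowerDensity I := by
  obtain ⟨-, hE, -, hU, hL⟩ := dimensions_cantorProb p hp I
  have hlow : ∀ K : RestrictionSet (cantorProb p hp I),
      lowerDensity I ≤ lowerHausdorffDim (condOn (cantorProb p hp I) K.1) := fun K =>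
    hL ▸ lowerHausdorffDim_condOn_ge _ K
  have hup : upperHausdorffDim (condOn (cantorProb p hp I)
      (RestrictionSet.whole (cantorProb p hp I)).1) = lowerDensity I := by
    rw [upperHausdorffDim_condOn_univ, hU]
  refine ⟨le_antisymm (iInf_le_of_le (RestrictionSet.whole (cantorProb p hp I)) ?_)
      (le_iInf fun K => upperDensity_le_upperEntropyDim_condOn hp I K),
    le_antisymm (iInf_le_of_le (RestrictionSet.whole (cantorProb p hp I)) hup.le)
      (le_iInf fun K => (hlow K).trans (lowerHausdorffDim_le_upperHausdorffDim _)),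
    le_antisymm (iInf_le_of_le (RestrictionSet.whole (cantorProb p hp I))
      ((lowerHausdorffDim_le_upperHausdorffDim _).trans hup.le)) (le_iInf hlow)⟩
  rw [upperEntropyDim_condOn_univ, hE]

/-- The strict inequality between the dimensions, together with spectrality. -/
theorem isSpectrum_and_dimH_lt (p : ℕ) (hp : 2 ≤ p) {I : Set ℕ}
    (h : lowerDensity I < upperDensity I) :
    IsSpectrum (cantorProb p hp I : Measure ℝ) (cantorSpectrum p I) ∧
      dimH (cantorProb p hp I : Measure ℝ).support < beurlingDim (cantorSpectrum p I) := by
  have := isProbabilityMeasure_cantorMeasure hp I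
  obtain ⟨hB, -, hS, -, -⟩ := dimensions_cantorProb p hp I
  refine ⟨isSpectrum_cantorMeasure hp (infinite_compl_of_lowerDensity_lt h), ?_⟩
  rw [hB, hS]
  exact h

end BeurlingDim

theorem mainTheorem3 :
    (∀ (p : ℕ) (hp : 2 ≤ p) (I : Set ℕ),
      ∃ ν : ProbabilityMeasure ℝ,
        Tendsto (BeurlingDim.cantorApprox p hp I) atTop (𝓝 ν) ∧
        IsCompact (ν : Measure ℝ).support ∧
        -- Beurling dimension and entropy dimension
        BeurlingDim.beurlingDim (BeurlingDim.cantorSpectrum p I)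
          = BeurlingDim.upperEntropyDim (ν : Measure ℝ) ∧
        BeurlingDim.upperEntropyDim (ν : Measure ℝ) = BeurlingDim.upperDensity I ∧
        -- Hausdorff dimensions
        dimH (ν : Measure ℝ).support = BeurlingDim.upperHausdorffDim (ν : Measure ℝ) ∧
        BeurlingDim.upperHausdorffDim (ν : Measure ℝ)
          = BeurlingDim.lowerHausdorffDim (ν : Measure ℝ) ∧
        BeurlingDim.lowerHausdorffDim (ν : Measure ℝ) = BeurlingDim.lowerDensity I ∧
        -- dimensions of the normalised restrictions
        BeurlingDim.upperEntropyDim (ν : Measure ℝ)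
          = ⨅ K : BeurlingDim.RestrictionSet ν,
              BeurlingDim.upperEntropyDim (BeurlingDim.condOn ν K.1) ∧
        dimH (ν : Measure ℝ).support
          = ⨅ K : BeurlingDim.RestrictionSet ν,
              BeurlingDim.upperHausdorffDim (BeurlingDim.condOn ν K.1) ∧
        dimH (ν : Measure ℝ).support
          = ⨅ K : BeurlingDim.RestrictionSet ν,
              BeurlingDim.lowerHausdorffDim (BeurlingDim.condOn ν K.1) ∧
        -- spectrality
        (Iᶜ.Infinite →
          BeurlingDim.IsSpectrum (ν : Measure ℝ) (BeurlingDim.cantorSpectrum p I)) ∧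
        -- the strict inequality
        (BeurlingDim.lowerDensity I < BeurlingDim.upperDensity I →
          BeurlingDim.IsSpectrum (ν : Measure ℝ) (BeurlingDim.cantorSpectrum p I) ∧
          dimH (ν : Measure ℝ).support
            < BeurlingDim.beurlingDim (BeurlingDim.cantorSpectrum p I))) ∧
    (∃ I : Set ℕ, BeurlingDim.lowerDensity I < BeurlingDim.upperDensity I) ∧
    -- the Hausdorff dimension of the support does not bound the Beurling dimension
    ¬ ∀ (μ : ProbabilityMeasure ℝ) (Λ : Set ℝ), Λ.Countable →
        BeurlingDim.IsFrameSpectrum (μ : Measure ℝ) Λ →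
        IsCompact (μ : Measure ℝ).support →
        BeurlingDim.beurlingDim Λ ≤ dimH (μ : Measure ℝ).support := by
  refine ⟨fun p hp I => ?_, ⟨_, BeurlingDim.lowerDensity_lt_upperDensity_even_log⟩, fun hall => ?_⟩
  · have := BeurlingDim.isProbabilityMeasure_cantorMeasure hp I
    obtain ⟨hB, hE, hS, hU, hL⟩ := BeurlingDim.dimensions_cantorProb p hp I
    obtain ⟨hE', hU', hL'⟩ := BeurlingDim.iInf_dimensions_condOn_cantorProb p hp I
    exact ⟨BeurlingDim.cantorProb p hp I, BeurlingDim.tendsto_cantorApprox hp I,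
      BeurlingDim.isCompact_support_cantorMeasure hp I, hB.trans hE.symm, hE, hS.trans hU.symm,
      hU.trans hL.symm, hL, hE.trans hE'.symm, hS.trans hU'.symm, hS.trans hL'.symm,
      fun hI => BeurlingDim.isSpectrum_cantorMeasure hp hI,
      fun h => BeurlingDim.isSpectrum_and_dimH_lt p hp h⟩
  · obtain ⟨hspec, hlt⟩ := BeurlingDim.isSpectrum_and_dimH_lt 2 le_rfl
      BeurlingDim.lowerDensity_lt_upperDensity_even_log
    exact absurd (hall (BeurlingDim.cantorProb 2 le_rfl _) _
      (BeurlingDim.countable_cantorSpectrum 2 _) ⟨1, 1, one_pos, one_pos, hspec⟩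
      (BeurlingDim.isCompact_support_cantorMeasure le_rfl _)) (not_le.2 hlt)
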